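/- For an integer $m\neq 0$ and an integer $r\ge 1$ let $L_m(r)=\sum_{l>0,\ l\text{ odd}}\left(\frac{-m}{l}\right)\frac1{l^{r}}$, where $\left(\frac{\cdot}{\cdot}\right)$ is the Jacobi symbol and the series is summed in increasing order of $l$. For $m\ge 1$ put $K_1=\frac12$ and $K_m=1$ for $m>1$, and let $$c_{m,n}=\frac{(2n)!\,L_m(2n+1)}{K_m\sqrt m}\left(\frac{\pi}{2m}\right)^{-2n-1}\ (n\ge 0),\qquad d_{m,n}=\frac{(2n-1)!\,L_{-m}(2n)}{K_m\sqrt m}\left(\frac{\pi}{2m}\right)^{-2n}\ (n\ge 1).$$ Shanks' generalized Euler and class numbers are $s_{m,n}=c_{m,n/2}$ for even $n\ge 0$ and $s_{m,n}=d_{m,(n+1)/2}$ for odd $n$; their exponential generating function is $s_m(x)=\sum_{n\ge 0}s_{m,n}\frac{x^n}{n!}$. For integers $0\le p\le m$ let $$\Lambda_{m,p}(x)=\frac{\cos((m-p)x)+\sin(px)}{\cos(mx)}.$$ **Theorem.** Let $m=4t+3$ with an integer $t\ge 0$, and assume that $m$ is square-free. Then the series $L_m(2n+1)$ $(n\ge0)$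 and $L_{-m}(2n)$ $(n\ge1)$ converge, and for every complex $x$ with $|x|<\frac{\pi}{2m}$ the series $s_m(x)$ converges and $$s_m(x)=\sum_{k=1}^{t}\left(\frac{k}{m}\right)\Lambda_{m,4k}(x)+\sum_{k=t+1}^{2t+1}\left(\frac{k}{m}\right)\Lambda_{m,2m-4k}(x).$$ -/

import Mathlib

open Filter Topology

open scoped NumberTheorySymbols

namespace ShanksNumbers

/-- The partial sum, over the odd positive integers `l < N`, of the Dirichlet series
`L_m(s) = ∑ (-m / l) / l ^ s` with the Jacobi symbol `(-m / l)`; here `m` is any integer. -/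
noncomputable def dirichletPartialSum (m : ℤ) (s N : ℕ) : ℝ :=
  ∑ l ∈ (Finset.range N).filter Odd, (J(-m | l) : ℝ) / (l : ℝ) ^ s

/-- The value `L_m(s)` of the Dirichlet series, summed in increasing order of `l`
(at `s = 1` the convergence is only conditional). -/
noncomputable def L (m : ℤ) (s : ℕ) : ℝ :=
  limUnder atTop (dirichletPartialSum m s)

/-- The normalizing constant: `K_1 = 1/2` and `K_m = 1` otherwise. -/
noncomputable def K (m : ℕ) : ℝ := if m = 1 then 1 / 2 else 1

/-- `c_{m,n} = (2n)! L_m(2n+1) (K_m √m)⁻¹ (π/(2m))^{-2n-1}`, for `n ≥ 0`. -/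
noncomputable def c (m n : ℕ) : ℝ :=
  ((2 * n).factorial : ℝ) * L (m : ℤ) (2 * n + 1) * (K m * √(m : ℝ))⁻¹ *
    (Real.pi / (2 * m)) ^ (-2 * (n : ℤ) - 1)

/-- `d_{m,n} = (2n-1)! L_{-m}(2n) (K_m √m)⁻¹ (π/(2m))^{-2n}`, for `n ≥ 1`. -/
noncomputable def d (m n : ℕ) : ℝ :=
  ((2 * n - 1).factorial : ℝ) * L (-(m : ℤ)) (2 * n) * (K m * √(m : ℝ))⁻¹ *
    (Real.pi / (2 * m)) ^ (-2 * (n : ℤ))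

/-- The generalized Euler and class numbers `s_{m,n}`. -/
noncomputable def s (m n : ℕ) : ℝ :=
  if Even n then c m (n / 2) else d m ((n + 1) / 2)

/-- `Λ_{m,p}(x) = (cos((m-p)x) + sin(px)) / cos(mx)`. -/
noncomputable def Lam (m p : ℤ) (x : ℂ) : ℂ :=
  (Complex.cos (((m : ℂ) - (p : ℂ)) * x) + Complex.sin ((p : ℂ) * x)) /
    Complex.cos ((m : ℂ) * x)

end ShanksNumbers

/-! For `m = 4t+3` square-free, the Gauss sum of the Jacobi symbol gives the finite Fourier
expansion `(l/m) √m = 2 ∑ (k/m) sin(2πkl/m)`, `1 ≤ k ≤ 2t+1` (`jacobiSym_mul_sqrt`). By reciprocity,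
for odd `l`, `(-m/l) = (l/m)` and `(m/l) = (-1)^((l-1)/2) (l/m)`. With `θ = 2πk/m`, this makes
`L_m(2n+1)` and `L_{-m}(2n+2)` finite combinations of the series `∑ sin(lθ)/l^(2n+1)` and `∑
cos(l|π/2-θ|)/l^(2n+2)` over odd `l`.

The generating functions of those series are elementary. Put `z = 2mx/π`, so that `|z| < 1`. The
Fourier series in odd frequencies of `sin(z(π/2-φ))` and `cos(z(π/2-θ))`, re-expanded in powers of
`z`, give the quotients `sin(z(π/2-φ))/cos(zπ/2)` and `cos(z(π/2-θ))/cos(zπ/2)` (`hasSum_pow_odd`,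
`hasSum_pow_even`). Since `zπ/2 = mx` and `zθ = 4kx`, taking `φ = |π/2-θ|` and adding the two
produces `Λ_{m,4k}` or `Λ_{m,2m-4k}` according to the sign of `π/2-θ`.

Two points need more than formal work. The sign of the Gauss sum is found by Gauss's own method: an
alternating sum of Gaussian binomials at a root of unity turns `∑ ζ^(n²)` into a product of sines
whose signs can be counted (`quadSum_one`), and multiplicativity carries this to the Jacobi symbol
(`charSum_eq`). The series with exponent 1 converges only conditionally; it is the square wave,
treated by Dirichlet's test and Abel's theorem (`tendsto_sum_sin_odd_div`). -/

namespace ShanksNumbers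

/-! ### Gaussian binomial coefficients and Gauss's product formula -/

section QBinomial

variable {R : Type*} [CommRing R]

/-- The Gaussian binomial coefficient, evaluated at `q`. -/
def qBinom (q : R) : ℕ → ℕ → R
  | _, 0 => 1
  | 0, _ + 1 => 0
  | n + 1, k + 1 => qBinom q n k + q ^ (k + 1) * qBinom q n (k + 1)

@[simp] lemma qBinom_zero_right (q : R) (n : ℕ) : qBinom q n 0 = 1 := by
  cases n <;> rfl

lemma qBinom_succ_succ (q : R) (n k : ℕ) :
    qBinom q (n + 1) (k + 1) = qBinom q n k + q ^ (k + 1) * qBinom q n (k + 1) := rfl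

lemma qBinom_eq_zero_of_lt (q : R) {n k : ℕ} (h : n < k) : qBinom q n k = 0 := by
  induction n generalizing k with
  | zero => obtain ⟨k, rfl⟩ := Nat.exists_eq_succ_of_ne_zero h.ne'; rfl
  | succ n ih =>
    obtain ⟨k, rfl⟩ := Nat.exists_eq_succ_of_ne_zero (Nat.ne_zero_of_lt h)
    rw [Nat.succ_eq_add_one, qBinom_succ_succ, ih (by omega), ih (by omega)]
    simp

/-- The mirror image of the defining Pascal rule. Comparing the two rules gives the ratio of
neighbouring coefficients without any division, so that `q` may be a root of unity. -/
lemma qBinom_succ_succ' (q : R) {n k : ℕ} (h : k ≤ n) :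
    qBinom q (n + 1) (k + 1) = q ^ (n - k) * qBinom q n k + qBinom q n (k + 1) := by
  induction n generalizing k with
  | zero =>
    obtain rfl : k = 0 := by omega
    simp [qBinom]
  | succ n ih =>
    rcases h.eq_or_lt with rfl | h
    · rw [qBinom_succ_succ, qBinom_eq_zero_of_lt q (Nat.lt_succ_self _)]
      simp
    · rw [qBinom_succ_succ q (n + 1) k]
      have i₁ := ih (by omega : k ≤ n)
      have p₁ := qBinom_succ_succ q n k
      cases k with
      | zero =>
        simp only [qBinom_zero_right, Nat.sub_zero] at i₁ p₁ ⊢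
        linear_combination q * i₁ - p₁
      | succ k =>
        have i₂ := ih (by omega : k ≤ n)
        have p₂ := qBinom_succ_succ q n k
        obtain ⟨j, rfl⟩ : ∃ j, n = k + 1 + j := ⟨n - (k + 1), by omega⟩
        rw [show k + 1 + j - k = j + 1 by omega] at i₂
        rw [show k + 1 + j - (k + 1) = j by omega] at i₁
        rw [show k + 1 + j + 1 - (k + 1) = j + 1 by omega]
        linear_combination i₂ + q ^ (k + 2) * i₁ - q ^ (j + 1) * p₂ - p₁

lemma one_sub_pow_mul_qBinom (q : R) {n k : ℕ} (h : k ≤ n) :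
    (1 - q ^ (n - k)) * qBinom q n k = (1 - q ^ (k + 1)) * qBinom q n (k + 1) := by
  linear_combination (qBinom_succ_succ q n k).symm.trans (qBinom_succ_succ' q h)

lemma one_sub_pow_mul_qBinom_succ (q : R) {n k : ℕ} (h : k ≤ n + 1) :
    (1 - q ^ (n + 1 - k)) * qBinom q (n + 1) k = (1 - q ^ (n + 1)) * qBinom q n k := by
  cases k with
  | zero => simp
  | succ k =>
    have h' := one_sub_pow_mul_qBinom q (show k ≤ n by omega)
    obtain ⟨j, rfl⟩ : ∃ j, n = k + j := ⟨n - k, by omega⟩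
    rw [show k + j - k = j by omega] at h'
    rw [show k + j + 1 - (k + 1) = j by omega, qBinom_succ_succ]
    linear_combination h'

/-- Gauss's alternating sum of Gaussian binomial coefficients. -/
def altSum (q : R) (n : ℕ) : R := ∑ k ∈ Finset.range (n + 1), (-1) ^ k * qBinom q n k

/-- The mirrored Pascal rule splits each term into a telescoping difference and a remainder `(1 -
q^(n+1-k))` times a coefficient of row `n+1`, which the absorption identity turns into `1 - q^(n+1)`
times one of row `n`. -/
lemma altSum_add_two (q : R) (n : ℕ) : altSum q (n + 2) = (1 - q ^ (n + 1)) * altSum q n := by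
  unfold altSum
  rw [Finset.sum_range_succ']
  have h1 : ∀ k ∈ Finset.range (n + 2), (-1 : R) ^ (k + 1) * qBinom q (n + 2) (k + 1) =
      ((-1) ^ (k + 1) * qBinom q (n + 1) (k + 1) - (-1) ^ k * qBinom q (n + 1) k) +
        (1 - q ^ (n + 1)) * ((-1) ^ k * qBinom q n k) := by
    intro k hk
    rw [Finset.mem_range] at hk
    rw [qBinom_succ_succ' q (show k ≤ n + 1 by omega)]
    linear_combination (-(-1) ^ k) * (- one_sub_pow_mul_qBinom_succ q (show k ≤ n + 1 by omega))
  rw [Finset.sum_congr rfl h1, Finset.sum_add_distrib, Finset.sum_range_sub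
    (fun k => (-1 : R) ^ k * qBinom q (n + 1) k), ← Finset.mul_sum, Finset.sum_range_succ _ (n + 1),
    qBinom_eq_zero_of_lt q (show n + 1 < n + 2 by omega),
    qBinom_eq_zero_of_lt q (show n < n + 1 by omega)]
  simp

lemma altSum_two_mul (q : R) (h : ℕ) :
    altSum q (2 * h) = ∏ j ∈ Finset.range h, (1 - q ^ (2 * j + 1)) := by
  induction h with
  | zero => simp [altSum]
  | succ h ih => rw [mul_add, mul_one, altSum_add_two, ih, Finset.prod_range_succ, mul_comm]

end QBinomial

/-- At `q = ζ⁻²` the relation `ζ^(2h+1) = 1` gives `q^(2h-k) = u` and `q^(k+1) = u⁻¹` with `u =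
ζ^(2(k+1))`, so consecutive coefficients have ratio `(1-u)/(1-u⁻¹) = -u`. The alternating signs then
cancel in `altSum`. -/
lemma qBinom_of_isPrimitiveRoot {F : Type*} [Field F] {ζ : F} {h : ℕ}
    (hζ : IsPrimitiveRoot ζ (2 * h + 1)) {k : ℕ} (hk : k ≤ 2 * h) :
    qBinom (ζ⁻¹ ^ 2) (2 * h) k = (-1) ^ k * ζ ^ (k * (k + 1)) := by
  have h0 : ζ ≠ 0 := hζ.ne_zero (by omega)
  induction k with
  | zero => simp
  | succ k ih =>
    have key := one_sub_pow_mul_qBinom (ζ⁻¹ ^ 2) (show k ≤ 2 * h by omega)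
    rw [ih (by omega)] at key
    -- The modulus `2h+1` is prime to 2 and exceeds `k+1`, so the denominator of the ratio does not
    -- vanish.
    have hu : ζ ^ (2 * (k + 1)) ≠ 1 := by
      intro hu
      have h2 := hζ.dvd_of_pow_eq_one _ hu
      have h3 : 2 * h + 1 ∣ k + 1 :=
        Nat.Coprime.dvd_of_dvd_mul_left (by simp) h2
      exact absurd (Nat.le_of_dvd (by omega) h3) (by omega)
    have e1 : (ζ⁻¹ ^ 2) ^ (2 * h - k) = ζ ^ (2 * (k + 1)) := by
      rw [← pow_mul, inv_pow]
      refine inv_eq_of_mul_eq_one_left ?_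
      rw [← pow_add,
        show 2 * (k + 1) + 2 * (2 * h - k) = (2 * h + 1) * 2 by omega, pow_mul, hζ.pow_eq_one,
        one_pow]
    have e2 : (ζ⁻¹ ^ 2) ^ (k + 1) = (ζ ^ (2 * (k + 1)))⁻¹ := by
      rw [← pow_mul, inv_pow]
    rw [e1, e2] at key
    have hu0 : ζ ^ (2 * (k + 1)) ≠ 0 := pow_ne_zero _ h0
    have e3 : ζ ^ ((k + 1) * (k + 1 + 1)) = ζ ^ (k * (k + 1)) * ζ ^ (2 * (k + 1)) := by
      rw [← pow_add]; ring_nf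
    rw [e3]
    generalize ζ ^ (2 * (k + 1)) = u at *
    generalize qBinom (ζ⁻¹ ^ 2) (2 * h) (k + 1) = X at *
    generalize ζ ^ (k * (k + 1)) = Y at *
    have hu1 : u - 1 ≠ 0 := sub_ne_zero.mpr hu
    field_simp at key
    apply mul_left_cancel₀ hu1
    linear_combination -key

/-- Gauss's product formula for a sum of powers `ζ ^ (k (k + 1))` of a root of unity. -/
lemma sum_pow_mul_succ {F : Type*} [Field F] {ζ : F} {h : ℕ}
    (hζ : IsPrimitiveRoot ζ (2 * h + 1)) :
    ∑ k ∈ Finset.range (2 * h + 1), ζ ^ (k * (k + 1)) =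
      ∏ j ∈ Finset.range h, (1 - (ζ⁻¹ ^ 2) ^ (2 * j + 1)) := by
  rw [← altSum_two_mul, altSum]
  refine Finset.sum_congr rfl fun k hk => ?_
  rw [Finset.mem_range] at hk
  rw [qBinom_of_isPrimitiveRoot hζ (by omega), ← mul_assoc, ← mul_pow]
  simp

/-! ### Additive characters modulo `m` and sums over residues -/

/-- `eUnit m a = exp (2 π i a / m)`. -/
noncomputable def eUnit (m : ℕ) (a : ℤ) : ℂ := Complex.exp (2 * Real.pi * Complex.I * (a / m))

lemma eUnit_add (m : ℕ) (a b : ℤ) : eUnit m (a + b) = eUnit m a * eUnit m b := by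
  rw [eUnit, eUnit, eUnit, ← Complex.exp_add]; push_cast; ring_nf

@[simp] lemma eUnit_zero (m : ℕ) : eUnit m 0 = 1 := by simp [eUnit]

lemma eUnit_ne_zero (m : ℕ) (a : ℤ) : eUnit m a ≠ 0 := Complex.exp_ne_zero _

lemma eUnit_neg (m : ℕ) (a : ℤ) : eUnit m (-a) = (eUnit m a)⁻¹ := by
  rw [eUnit, eUnit, ← Complex.exp_neg]; push_cast; ring_nf

lemma eUnit_natCast_mul (m n : ℕ) (a : ℤ) : eUnit m (n * a) = eUnit m a ^ n := by
  rw [eUnit, eUnit, ← Complex.exp_nat_mul]; push_cast; ring_nf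

lemma eUnit_natCast (m n : ℕ) : eUnit m n = eUnit m 1 ^ n := by
  rw [← eUnit_natCast_mul, mul_one]

lemma eUnit_mul_self {m : ℕ} (hm : m ≠ 0) (a : ℤ) : eUnit m (m * a) = 1 := by
  have : (m : ℂ) ≠ 0 := by exact_mod_cast hm
  rw [eUnit, Complex.exp_eq_one_iff]
  refine ⟨a, ?_⟩
  push_cast; field_simp

lemma isPrimitiveRoot_eUnit {m : ℕ} (hm : m ≠ 0) : IsPrimitiveRoot (eUnit m 1) m := by
  have := Complex.isPrimitiveRoot_exp m hm
  convert this using 1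
  rw [eUnit]; push_cast; ring_nf

lemma conj_eUnit (m : ℕ) (a : ℤ) : (starRingEnd ℂ) (eUnit m a) = eUnit m (-a) := by
  rw [eUnit, eUnit, ← Complex.exp_conj]
  congr 1
  simp only [map_mul, map_div₀, Complex.conj_ofReal, Complex.conj_I, map_intCast, map_natCast,
    map_ofNat, Int.cast_neg]
  ring

lemma eUnit_sub_eUnit_neg (m : ℕ) (a : ℤ) :
    eUnit m a - eUnit m (-a) = 2 * Complex.I * (Real.sin (2 * Real.pi * (a / m)) : ℝ) := by
  rw [eUnit, eUnit, Complex.ofReal_sin, Complex.sin]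
  push_cast
  have h1 : -(2 * (Real.pi : ℂ) * (a / m)) * Complex.I =
    2 * Real.pi * Complex.I * (-a / m) := by ring
  have h2 : (2 * (Real.pi : ℂ) * (a / m)) * Complex.I = 2 * Real.pi * Complex.I * (a / m) := by ring
  rw [h1, h2]
  linear_combination (-(Complex.exp (2 * Real.pi * Complex.I * (-a / m)) -
    Complex.exp (2 * Real.pi * Complex.I * (a / m)))) * Complex.I_sq

lemma sum_range_eq_sum_zmod {m : ℕ} [NeZero m] (f : ℤ → ℂ) :
    ∑ k ∈ Finset.range m, f k = ∑ x : ZMod m, f (x.val : ℤ) := by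
  refine Finset.sum_bij' (fun k _ => (k : ZMod m)) (fun x _ => x.val) ?_ ?_ ?_ ?_ ?_
  · simp
  · intro x _; simpa using ZMod.val_lt x
  · intro k hk; exact ZMod.val_cast_of_lt (Finset.mem_range.mp hk)
  · intro x _; simp
  · intro k hk; rw [ZMod.val_cast_of_lt (Finset.mem_range.mp hk)]

/-- A function on `ℤ` that is `m`-periodic may be summed over any complete residue system. -/
lemma sum_eq_sum_range_of_bijective {ι : Type*} [Fintype ι] {m : ℕ} (hm : m ≠ 0) {f : ℤ → ℂ}
    (hf : ∀ a b : ℤ, (a : ZMod m) = b → f a = f b) (g : ι → ℤ)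
    (hg : Function.Bijective fun i => (g i : ZMod m)) :
    ∑ i, f (g i) = ∑ k ∈ Finset.range m, f k := by
  have : NeZero m := ⟨hm⟩
  rw [sum_range_eq_sum_zmod]
  refine Function.Bijective.sum_comp hg (fun x => f (x.val : ℤ)) |>.symm ▸ ?_
  refine Finset.sum_congr rfl fun i _ => hf _ _ ?_
  simp

lemma eUnit_congr {m : ℕ} (hm : m ≠ 0) {a b : ℤ} (h : (a : ZMod m) = b) :
    eUnit m a = eUnit m b := by
  rw [ZMod.intCast_eq_intCast_iff] at h
  obtain ⟨c, hc⟩ := h.dvd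
  obtain rfl : b = a + m * c := by linarith
  rw [eUnit_add, eUnit_mul_self hm, mul_one]

/-! ### The quadratic Gauss sum and its sign -/

/-- The quadratic Gauss sum `∑ exp (2 π i a n² / m)`. -/
noncomputable def quadSum (m : ℕ) (a : ℤ) : ℂ := ∑ n ∈ Finset.range m, eUnit m (a * (n : ℤ) ^ 2)

lemma sum_range_shift {m : ℕ} (hm : m ≠ 0) {f : ℤ → ℂ}
    (hf : ∀ a b : ℤ, (a : ZMod m) = b → f a = f b) (c : ℤ) :
    ∑ k ∈ Finset.range m, f (k + c) = ∑ k ∈ Finset.range m, f k := by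
  have : NeZero m := ⟨hm⟩
  have e1 := sum_eq_sum_range_of_bijective hm (f := fun k => f (k + c))
    (fun a b h => hf _ _ (by push_cast; rw [h])) (fun x : ZMod m => (x.val : ℤ))
    (by simp)
  have e2 := sum_eq_sum_range_of_bijective hm hf (fun x : ZMod m => (x.val : ℤ) + c)
    (by simpa using (Equiv.addRight (c : ZMod m)).bijective)
  rw [← e1, ← e2]

/-- Modulo `2h+1` one has `(k-h)² ≡ h² + k(k+1)`, so a shift reduces the sum to `sum_pow_mul_succ`.
The leftover `ζ^(h²)` is the product of the `ζ^(2j+1)`, and each factor becomes `ζ^a - ζ^(-a)` with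
`a = 2j+1`. -/
lemma quadSum_one_eq_prod (h : ℕ) :
    quadSum (2 * h + 1) 1 =
      ∏ j ∈ Finset.range h,
        (2 * Complex.I * (Real.sin (2 * Real.pi * ((2 * j + 1 : ℕ) / (2 * h + 1 : ℕ))) : ℝ)) := by
  have hm : 2 * h + 1 ≠ 0 := by omega
  set m := 2 * h + 1 with hmd
  set ζ := eUnit m 1 with hζd
  have hζ : IsPrimitiveRoot ζ m := isPrimitiveRoot_eUnit hm
  have h0 : ζ ≠ 0 := eUnit_ne_zero _ _
  have hshift : quadSum m 1 = ζ ^ (h ^ 2) * ∑ k ∈ Finset.range m, ζ ^ (k * (k + 1)) := by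
    have := sum_range_shift hm (f := fun k => eUnit m (1 * k ^ 2))
      (fun a b hab => eUnit_congr hm (by push_cast; rw [hab])) (-h : ℤ)
    rw [quadSum, ← this, Finset.mul_sum]
    refine Finset.sum_congr rfl fun k _ => ?_
    rw [← pow_add, ← eUnit_natCast]
    apply eUnit_congr hm
    have hz : ((2 * h + 1 : ℕ) : ZMod m) = 0 := by rw [← hmd]; simp
    push_cast at hz ⊢
    linear_combination (-(k : ZMod m)) * hz
  have hsq : ∀ n : ℕ, ζ ^ (n ^ 2) = ∏ j ∈ Finset.range n, ζ ^ (2 * j + 1) := by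
    intro n
    rw [Finset.prod_pow_eq_pow_sum]
    congr 1
    induction n with
    | zero => simp
    | succ n ih => rw [Finset.sum_range_succ, ← ih]; ring
  rw [hshift, sum_pow_mul_succ hζ, hsq, ← Finset.prod_mul_distrib]
  refine Finset.prod_congr rfl fun j _ => ?_
  have := eUnit_sub_eUnit_neg m (2 * j + 1 : ℕ)
  rw [eUnit_neg, eUnit_natCast, ← hζd] at this
  rw [Int.cast_natCast] at this
  rw [← this, ← pow_mul, inv_pow]
  have : ζ ^ (2 * j + 1) ≠ 0 := pow_ne_zero _ h0
  rw [mul_comm 2 (2 * j + 1), pow_mul]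
  field_simp

lemma quadSum_one_eq_I_mul (t : ℕ) :
    ∃ r : ℝ, 0 < r ∧ quadSum (4 * t + 3) 1 = Complex.I * r := by
  have key := quadSum_one_eq_prod (2 * t + 1)
  rw [show 2 * (2 * t + 1) + 1 = 4 * t + 3 by ring, Finset.prod_mul_distrib, Finset.prod_const,
    Finset.card_range, ← Complex.ofReal_prod] at key
  set P := ∏ j ∈ Finset.range (2 * t + 1),
    Real.sin (2 * Real.pi * ((2 * j + 1 : ℕ) / (4 * t + 3 : ℕ))) with hP
  -- The sine is positive for `j ≤ t`, where `2(2j+1) < 4t+3`, and negative for the remaining `t`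
  -- indices. This sign `(-1)^t` cancels the one in `I^(2t+1) = I (-1)^t`.
  have hpos : 0 < (-1) ^ t * P := by
    rw [hP, show 2 * t + 1 = (t + 1) + t by ring, Finset.prod_range_add]
    have hm : (0 : ℝ) < (4 * t + 3 : ℕ) := by positivity
    have h1 : 0 < ∏ j ∈ Finset.range (t + 1),
        Real.sin (2 * Real.pi * ((2 * j + 1 : ℕ) / (4 * t + 3 : ℕ))) := by
      refine Finset.prod_pos fun j hj => ?_
      have hj' : ((2 * j + 1 : ℕ) : ℝ) / (4 * t + 3 : ℕ) < 1 / 2 := by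
        rw [div_lt_div_iff₀ hm (by norm_num)]
        have : j < t + 1 := Finset.mem_range.mp hj
        exact_mod_cast (by omega : (2 * j + 1) * 2 < 1 * (4 * t + 3))
      apply Real.sin_pos_of_pos_of_lt_pi
      · positivity
      · nlinarith [Real.pi_pos]
    have h2 : 0 < (-1) ^ t * ∏ i ∈ Finset.range t,
        Real.sin (2 * Real.pi * ((2 * (t + 1 + i) + 1 : ℕ) / (4 * t + 3 : ℕ))) := by
      have : (-1 : ℝ) ^ t = ∏ i ∈ Finset.range t, (-1) := by simp
      rw [this, ← Finset.prod_mul_distrib]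
      refine Finset.prod_pos fun i hi => ?_
      have hi : i < t := Finset.mem_range.mp hi
      have a1 : 1 / 2 < ((2 * (t + 1 + i) + 1 : ℕ) : ℝ) / (4 * t + 3 : ℕ) := by
        rw [div_lt_div_iff₀ (by norm_num) hm]
        exact_mod_cast (by omega : 1 * (4 * t + 3) < (2 * (t + 1 + i) + 1) * 2)
      have a2 : ((2 * (t + 1 + i) + 1 : ℕ) : ℝ) / (4 * t + 3 : ℕ) < 1 := by
        rw [div_lt_one hm]
        exact_mod_cast (by omega : 2 * (t + 1 + i) + 1 < 4 * t + 3)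
      rw [neg_one_mul, neg_pos, ← Real.sin_sub_two_pi]
      apply Real.sin_neg_of_neg_of_neg_pi_lt <;> nlinarith [Real.pi_pos]
    have := mul_pos h1 h2
    linarith
  refine ⟨2 ^ (2 * t + 1) * ((-1) ^ t * P), by positivity, ?_⟩
  rw [key, mul_pow, pow_succ Complex.I, pow_mul Complex.I, Complex.I_sq]
  push_cast
  ring

lemma sum_eUnit_mul_eq_zero {m : ℕ} (hm : m ≠ 0) {c : ℤ} (hc : (c : ZMod m) ≠ 0) :
    ∑ b ∈ Finset.range m, eUnit m (c * b) = 0 := by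
  have h1 : ∀ b ∈ Finset.range m, eUnit m (c * b) = eUnit m c ^ b := fun b _ => by
    rw [mul_comm, eUnit_natCast_mul]
  have hne : eUnit m c ≠ 1 := by
    intro h
    have h2 : eUnit m 1 ^ c = 1 := by
      rw [← h, eUnit, eUnit, ← Complex.exp_int_mul]; push_cast; ring_nf
    rw [(isPrimitiveRoot_eUnit hm).zpow_eq_one_iff_dvd] at h2
    exact hc ((ZMod.intCast_zmod_eq_zero_iff_dvd _ _).mpr h2)
  rw [Finset.sum_congr rfl h1, geom_sum_eq hne, ← eUnit_natCast_mul, eUnit_mul_self hm]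
  simp

/-- Replacing `a` by `a+b` changes `a² - b²` into `a² + 2ab`. The sum over `b` then vanishes unless
`m ∣ 2a`, which for odd `m` leaves only `a = 0`. -/
lemma quadSum_mul_conj {m : ℕ} (hm : Odd m) :
    quadSum m 1 * (starRingEnd ℂ) (quadSum m 1) = m := by
  have hm0 : m ≠ 0 := hm.pos.ne'
  have e : quadSum m 1 * (starRingEnd ℂ) (quadSum m 1) =
      ∑ b ∈ Finset.range m, ∑ a ∈ Finset.range m, eUnit m ((a : ℤ) ^ 2 - (b : ℤ) ^ 2) := by
    rw [quadSum, map_sum, Finset.sum_mul_sum, Finset.sum_comm]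
    refine Finset.sum_congr rfl fun b _ => Finset.sum_congr rfl fun a _ => ?_
    rw [conj_eUnit, ← eUnit_add]
    ring_nf
  have e2 : ∀ b ∈ Finset.range m, ∑ a ∈ Finset.range m, eUnit m ((a : ℤ) ^ 2 - (b : ℤ) ^ 2) =
      ∑ a ∈ Finset.range m, eUnit m ((a : ℤ) ^ 2) * eUnit m ((2 * a : ℤ) * b) := by
    intro b _
    have := sum_range_shift hm0 (f := fun k => eUnit m (k ^ 2 - (b : ℤ) ^ 2))
      (fun a c hab => eUnit_congr hm0 (by push_cast; rw [hab])) (b : ℤ)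
    rw [← this]
    refine Finset.sum_congr rfl fun a _ => ?_
    rw [← eUnit_add]; ring_nf
  rw [e, Finset.sum_congr rfl e2, Finset.sum_comm]
  simp_rw [← Finset.mul_sum]
  rw [Finset.sum_eq_single_of_mem 0 (Finset.mem_range.mpr hm.pos)]
  · simp
  · intro a ha ha0
    rw [sum_eUnit_mul_eq_zero hm0, mul_zero]
    intro h
    rw [ZMod.intCast_zmod_eq_zero_iff_dvd] at h
    have h' : m ∣ 2 * a := by exact_mod_cast h
    have h3 : m ∣ a := Nat.Coprime.dvd_of_dvd_mul_left (Nat.coprime_two_right.mpr hm) h'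
    exact absurd (Nat.le_of_dvd (by omega) h3) (by simpa using ha)

/-- Gauss's determination of the sign of the quadratic Gauss sum. -/
theorem quadSum_one (t : ℕ) :
    quadSum (4 * t + 3) 1 = Complex.I * (√((4 * t + 3 : ℕ) : ℝ) : ℝ) := by
  obtain ⟨r, hr, h⟩ := quadSum_one_eq_I_mul t
  have h2 := quadSum_mul_conj (m := 4 * t + 3) (by rw [Nat.odd_iff]; omega)
  rw [h, map_mul, Complex.conj_I, Complex.conj_ofReal] at h2
  have h3 : (r : ℂ) ^ 2 = ((4 * t + 3 : ℕ) : ℂ) := by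
    linear_combination h2 + (r : ℂ) ^ 2 * Complex.I_sq
  have h4 : r ^ 2 = ((4 * t + 3 : ℕ) : ℝ) := by exact_mod_cast h3
  rw [h, ← h4, Real.sqrt_sq hr.le]

/-! ### Gauss sums of the Jacobi symbol for square-free modulus -/

/-- The Gauss sum `∑ (k / m) exp (2 π i a k / m)` of the Jacobi symbol. -/
noncomputable def charSum (m : ℕ) (a : ℤ) : ℂ :=
  ∑ k ∈ Finset.range m, (J((k : ℤ) | m) : ℂ) * eUnit m (a * k)

lemma jacobiSym_congr {m : ℕ} {a b : ℤ} (h : (a : ZMod m) = b) : J(a | m) = J(b | m) :=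
  jacobiSym.mod_left' ((ZMod.intCast_eq_intCast_iff' a b m).mp h)

/-- Summation over residues modulo a product of coprime moduli. -/
lemma sum_range_mul_of_coprime {m n : ℕ} (hm : m ≠ 0) (hn : n ≠ 0) (h : m.Coprime n) {f : ℤ → ℂ}
    (hf : ∀ a b : ℤ, (a : ZMod (m * n)) = b → f a = f b) :
    ∑ k ∈ Finset.range (m * n), f k =
      ∑ a ∈ Finset.range m, ∑ b ∈ Finset.range n, f (a * n + b * m) := by
  have hmn : m * n ≠ 0 := mul_ne_zero hm hn
  have : NeZero (m * n) := ⟨hmn⟩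
  rw [← sum_eq_sum_range_of_bijective hmn hf
    (fun i : Fin m × Fin n => ((i.1 : ℕ) : ℤ) * n + ((i.2 : ℕ) : ℤ) * m), Fintype.sum_prod_type,
    Finset.sum_range]
  · simp_rw [Finset.sum_range]
  · rw [Fintype.bijective_iff_injective_and_card]
    refine ⟨?_, by simp [ZMod.card]⟩
    rintro ⟨a, b⟩ ⟨a', b'⟩ hab
    have hd : ((m * n : ℕ) : ℤ) ∣ (((a' : ℕ) : ℤ) * n + ((b' : ℕ) : ℤ) * m) -
        (((a : ℕ) : ℤ) * n + ((b : ℕ) : ℤ) * m) :=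
      ((ZMod.intCast_eq_intCast_iff _ _ _).mp hab).dvd
    push_cast at hd
    have hc : IsCoprime (m : ℤ) n := Nat.isCoprime_iff_coprime.mpr h
    have h1 : (m : ℤ) ∣ ((a' : ℕ) : ℤ) - ((a : ℕ) : ℤ) := by
      refine hc.dvd_of_dvd_mul_right ?_
      have := (Dvd.intro _ rfl : (m : ℤ) ∣ m * n).trans hd
      convert this.sub (Dvd.intro_left ((((b' : ℕ) : ℤ) - ((b : ℕ) : ℤ))) rfl) using 1
      ring
    have h2 : (n : ℤ) ∣ ((b' : ℕ) : ℤ) - ((b : ℕ) : ℤ) := by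
      refine hc.symm.dvd_of_dvd_mul_right ?_
      have := (Dvd.intro_left _ rfl : (n : ℤ) ∣ m * n).trans hd
      convert this.sub (Dvd.intro_left ((((a' : ℕ) : ℤ) - ((a : ℕ) : ℤ))) rfl) using 1
      ring
    have e1 : a = a' := Fin.ext
      (Nat.ModEq.eq_of_lt_of_lt ((Nat.modEq_iff_dvd).mpr h1) a.2 a'.2)
    have e2 : b = b' := Fin.ext
      (Nat.ModEq.eq_of_lt_of_lt ((Nat.modEq_iff_dvd).mpr h2) b.2 b'.2)
    rw [e1, e2]

lemma eUnit_mul_left {m n : ℕ} (hn : n ≠ 0) (a : ℤ) : eUnit (m * n) (a * n) = eUnit m a := by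
  rw [eUnit, eUnit]
  push_cast
  rw [mul_div_mul_right _ _ (by exact_mod_cast hn)]

lemma eUnit_mul_right {m n : ℕ} (hm : m ≠ 0) (a : ℤ) : eUnit (m * n) (a * m) = eUnit n a := by
  rw [mul_comm m n, eUnit_mul_left hm]

/-- The substitution `k = bn + cm` of the Chinese remainder theorem separates the variables. The two
cross symbols can stay unevaluated, since they also arise from the arguments `a n` and `a m` in
`quadSum_mul`; reciprocity is not needed here. -/
lemma charSum_mul {m n : ℕ} (hm : m ≠ 0) (hn : n ≠ 0) (h : m.Coprime n) (a : ℤ) :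
    charSum (m * n) a = J((n : ℤ) | m) * J((m : ℤ) | n) * (charSum m a * charSum n a) := by
  have : NeZero m := ⟨hm⟩
  have : NeZero n := ⟨hn⟩
  rw [charSum, sum_range_mul_of_coprime hm hn h
    (f := fun k => (J(k | m * n) : ℂ) * eUnit (m * n) (a * k)), charSum, charSum,
    Finset.sum_mul_sum, Finset.mul_sum]
  · refine Finset.sum_congr rfl fun b _ => ?_
    rw [Finset.mul_sum]
    refine Finset.sum_congr rfl fun c _ => ?_
    rw [jacobiSym.mul_right, show J((b * n + c * m : ℤ) | m) = J((b * n : ℤ) | m) from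
        jacobiSym_congr (by simp),
      show J((b * n + c * m : ℤ) | n) = J((c * m : ℤ) | n) from jacobiSym_congr (by simp),
      jacobiSym.mul_left, jacobiSym.mul_left, mul_add, eUnit_add, ← mul_assoc a, ← mul_assoc a,
      eUnit_mul_left hn, eUnit_mul_right hm]
    push_cast
    ring
  · intro b c hbc
    rw [jacobiSym_congr hbc, eUnit_congr (mul_ne_zero hm hn) (a := a * b) (b := a * c)]
    push_cast
    rw [hbc]

lemma quadSum_mul {m n : ℕ} (hm : m ≠ 0) (hn : n ≠ 0) (h : m.Coprime n) (a : ℤ) :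
    quadSum (m * n) a = quadSum m (a * n) * quadSum n (a * m) := by
  rw [quadSum, sum_range_mul_of_coprime hm hn h
    (f := fun k => eUnit (m * n) (a * k ^ 2)), quadSum, quadSum, Finset.sum_mul_sum]
  · refine Finset.sum_congr rfl fun b _ => Finset.sum_congr rfl fun c _ => ?_
    rw [← eUnit_mul_left (m := m) hn, ← eUnit_mul_right (n := n) hm, ← eUnit_add]
    apply eUnit_congr (mul_ne_zero hm hn)
    have : ((m * n : ℕ) : ZMod (m * n)) = 0 := ZMod.natCast_self _
    push_cast at this ⊢
    linear_combination (2 * (a : ZMod (m * n)) * b * c) * this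
  · intro b c hbc
    apply eUnit_congr (mul_ne_zero hm hn)
    push_cast
    rw [hbc]

lemma jacobiSym_val_prime (p : ℕ) [Fact p.Prime] (x : ZMod p) :
    J((x.val : ℤ) | p) = quadraticChar (ZMod p) x := by
  rw [← jacobiSym.legendreSym.to_jacobiSym, legendreSym]
  simp

lemma sum_jacobiSym_prime {p : ℕ} [Fact p.Prime] (hp : p ≠ 2) :
    ∑ k ∈ Finset.range p, (J((k : ℤ) | p) : ℂ) = 0 := by
  rw [sum_range_eq_sum_zmod (f := fun k => (J(k | p) : ℂ))]
  simp_rw [jacobiSym_val_prime]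
  rw [← Int.cast_sum, quadraticChar_sum_zero (by rwa [ZMod.ringChar_zmod_n])]
  simp

/-- For `a` invertible, substitute `a k` for `k` and use `(a/p)² = 1`. For `p ∣ a` both sides
vanish, because the character has sum zero. -/
lemma charSum_prime {p : ℕ} [Fact p.Prime] (hp : p ≠ 2) (a : ℤ) :
    charSum p a = J(a | p) * charSum p 1 := by
  have hp0 : p ≠ 0 := (Fact.out : p.Prime).ne_zero
  have : NeZero p := ⟨hp0⟩
  by_cases ha : (a : ZMod p) = 0
  · have h1 : J(a | p) = 0 := by
      rw [jacobiSym_congr (b := 0) (by simpa using ha),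
        jacobiSym.zero_left (Fact.out : p.Prime).one_lt]
    rw [h1, charSum, Int.cast_zero, zero_mul, ← sum_jacobiSym_prime hp]
    refine Finset.sum_congr rfl fun k _ => ?_
    rw [eUnit_congr hp0 (a := a * k) (b := 0) (by push_cast; rw [ha]; simp), eUnit_zero, mul_one]
  · have hJ : J(a | p) * J(a | p) = 1 := by
      rw [← sq]
      refine jacobiSym.sq_one ?_
      by_contra h
      have h0 := jacobiSym.eq_zero_iff_not_coprime.mpr h
      rw [← jacobiSym.legendreSym.to_jacobiSym, legendreSym.eq_zero_iff] at h0
      exact ha h0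
    have key := sum_eq_sum_range_of_bijective hp0 (f := fun k => (J(k | p) : ℂ) * eUnit p (1 * k))
      (fun b c hbc => by
        rw [jacobiSym_congr hbc, eUnit_congr hp0 (a := 1 * b) (b := 1 * c) (by simpa using hbc)])
      (fun x : ZMod p => a * (x.val : ℤ))
      (by simpa using (Equiv.mulLeft₀ (a : ZMod p) ha).bijective)
    rw [charSum, charSum, ← key, Finset.mul_sum,
      sum_range_eq_sum_zmod (f := fun k => (J(k | p) : ℂ) * eUnit p (a * k))]
    refine Finset.sum_congr rfl fun x _ => ?_
    have hJ' : (J(a | p) : ℂ) * J(a | p) = 1 := by exact_mod_cast hJ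
    rw [jacobiSym.mul_left, one_mul]
    push_cast
    linear_combination (-(J((x.val : ℤ) | p) : ℂ) * eUnit p (a * x.val)) * hJ'

/-- A residue `y` has `1 + (y/p)` square roots, and the sum coming from the constant 1 vanishes
because `p ∤ a`. -/
lemma quadSum_prime {p : ℕ} [Fact p.Prime] (hp : p ≠ 2) {a : ℤ} (ha : (a : ZMod p) ≠ 0) :
    quadSum p a = charSum p a := by
  have hp0 : p ≠ 0 := (Fact.out : p.Prime).ne_zero
  have : NeZero p := ⟨hp0⟩
  have h1 : quadSum p a = ∑ x : ZMod p, eUnit p (a * ((x ^ 2).val : ℤ)) := by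
    rw [quadSum, sum_range_eq_sum_zmod (f := fun k => eUnit p (a * k ^ 2))]
    refine Finset.sum_congr rfl fun x _ => eUnit_congr hp0 ?_
    simp
  have h2 : ∑ x : ZMod p, eUnit p (a * ((x ^ 2).val : ℤ)) =
      ∑ y : ZMod p, ((quadraticChar (ZMod p) y + 1 : ℤ) : ℂ) * eUnit p (a * (y.val : ℤ)) := by
    rw [← Finset.sum_fiberwise (s := Finset.univ) (g := fun x : ZMod p => x ^ 2)]
    refine Finset.sum_congr rfl fun y _ => ?_
    rw [← quadraticChar_card_sqrts (by rwa [ZMod.ringChar_zmod_n]), Int.cast_natCast,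
      ← nsmul_eq_mul, ← Finset.sum_const]
    have hs : ({x : ZMod p | x ^ 2 = y}.toFinset) = Finset.univ.filter (fun x => x ^ 2 = y) := by
      ext; simp
    rw [hs]
    refine Finset.sum_congr rfl fun x hx => ?_
    rw [(Finset.mem_filter.mp hx).2]
  have h3 := sum_eUnit_mul_eq_zero hp0 ha
  rw [sum_range_eq_sum_zmod (f := fun k => eUnit p (a * k))] at h3
  rw [h1, h2, charSum, sum_range_eq_sum_zmod (f := fun k => (J(k | p) : ℂ) * eUnit p (a * k))]
  simp_rw [jacobiSym_val_prime]
  push_cast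
  simp_rw [add_mul, one_mul]
  rw [Finset.sum_add_distrib, h3, add_zero]

/-- Induction over the prime factors; square-freeness makes the split-off prime coprime to the rest.
The first claim covers every `a`, as the Fourier expansion also needs `l` sharing a factor with `m`.
The second transfers the value of `quadSum m 1` to `charSum m 1`. -/
theorem charSum_and_quadSum_of_squarefree (m : ℕ) (hodd : Odd m) (hsq : Squarefree m) :
    (∀ a : ℤ, charSum m a = J(a | m) * charSum m 1) ∧
      ∀ a : ℤ, IsCoprime a m → quadSum m a = charSum m a := by
  induction m using induction_on_primes with
  | zero => simp at hodd
  | one => simp [charSum, quadSum]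
  | prime_mul p m hp ih =>
    have : Fact p.Prime := ⟨hp⟩
    obtain ⟨hpo, hmo⟩ := Nat.odd_mul.mp hodd
    obtain ⟨hc, -, hms⟩ := Nat.squarefree_mul_iff.mp hsq
    have hp2 : p ≠ 2 := by rintro rfl; exact absurd hpo (by decide)
    have hm0 : m ≠ 0 := hmo.pos.ne'
    have : NeZero m := ⟨hm0⟩
    obtain ⟨ih1, ih2⟩ := ih hmo hms
    have first : ∀ a : ℤ, charSum (p * m) a = J(a | p * m) * charSum (p * m) 1 := by
      intro a
      rw [charSum_mul hp.ne_zero hm0 hc, charSum_mul hp.ne_zero hm0 hc, charSum_prime hp2 a,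
        ih1 a, jacobiSym.mul_right]
      push_cast
      ring
    refine ⟨first, fun a ha => ?_⟩
    push_cast at ha
    have hpm : IsCoprime (p : ℤ) m := Nat.isCoprime_iff_coprime.mpr hc
    have hap : ((a * m : ℤ) : ZMod p) ≠ 0 := by
      intro h
      rw [ZMod.intCast_zmod_eq_zero_iff_dvd] at h
      have := (ha.of_mul_right_left.mul_left hpm.symm).isUnit_of_dvd' h dvd_rfl
      rw [Int.isUnit_iff] at this
      have := hp.two_le
      omega
    rw [first a, quadSum_mul hp.ne_zero hm0 hc, quadSum_prime hp2 hap,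
      ih2 _ (ha.of_mul_right_right.mul_left hpm), charSum_prime hp2, ih1 (a * p),
      charSum_mul hp.ne_zero hm0 hc, jacobiSym.mul_right, jacobiSym.mul_left, jacobiSym.mul_left]
    push_cast
    ring

theorem charSum_eq {t : ℕ} (hsq : Squarefree (4 * t + 3)) (a : ℤ) :
    charSum (4 * t + 3) a = J(a | 4 * t + 3) * (Complex.I * (√((4 * t + 3 : ℕ) : ℝ) : ℝ)) := by
  obtain ⟨h1, h2⟩ := charSum_and_quadSum_of_squarefree _ (by rw [Nat.odd_iff]; omega) hsq
  rw [h1, ← h2 1 isCoprime_one_left, quadSum_one]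

lemma jacobiSym_neg_of_three_mod_four {m : ℕ} (hm : m % 4 = 3) (a : ℤ) :
    J(-a | m) = -J(a | m) := by
  rw [jacobiSym.neg a (by rw [Nat.odd_iff]; omega), ZMod.χ₄_nat_three_mod_four hm]
  ring

/-- The finite Fourier expansion of the Jacobi symbol `(l / m)`, for `m ≡ 3 mod 4` square-free. -/
theorem jacobiSym_mul_sqrt {t : ℕ} (hsq : Squarefree (4 * t + 3)) (l : ℤ) :
    (J(l | 4 * t + 3) : ℝ) * √((4 * t + 3 : ℕ) : ℝ) =
      2 * ∑ k ∈ Finset.Icc 1 (2 * t + 1), (J((k : ℤ) | 4 * t + 3) : ℝ) *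
        Real.sin (l * (2 * Real.pi * k / (4 * t + 3 : ℕ))) := by
  set m := 4 * t + 3 with hm
  have hm0 : m ≠ 0 := by omega
  have key := charSum_eq hsq l
  rw [← hm] at key
  have e1 : charSum m l = ∑ k ∈ Finset.Icc 1 (2 * t + 1), (J((k : ℤ) | m) : ℂ) *
      (eUnit m (l * k) - eUnit m (-(l * k))) := by
    have hI : Finset.range m = insert 0
        (Finset.Icc 1 (2 * t + 1) ∪ Finset.Icc (2 * t + 2) (4 * t + 2)) := by
      ext k; simp only [Finset.mem_range, Finset.mem_insert, Finset.mem_union, Finset.mem_Icc]; omega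
    have hdisj : Disjoint (Finset.Icc 1 (2 * t + 1)) (Finset.Icc (2 * t + 2) (4 * t + 2)) := by
      rw [Finset.disjoint_left]; intro k; simp only [Finset.mem_Icc]; omega
    -- Pair `k` with `m-k`: the symbol is odd because `m ≡ 3 mod 4`, so each pair contributes a
    -- difference of conjugate exponentials, that is, a sine.
    have hr : ∑ k ∈ Finset.Icc (2 * t + 2) (4 * t + 2), (J((k : ℤ) | m) : ℂ) * eUnit m (l * k) =
        ∑ k ∈ Finset.Icc 1 (2 * t + 1), -((J((k : ℤ) | m) : ℂ) * eUnit m (-(l * k))) := by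
      refine Finset.sum_bij' (fun k _ => m - k) (fun k _ => m - k) ?_ ?_ ?_ ?_ ?_
      · intro k hk; simp only [Finset.mem_Icc] at hk ⊢; omega
      · intro k hk; simp only [Finset.mem_Icc] at hk ⊢; omega
      · intro k hk; simp only [Finset.mem_Icc] at hk; omega
      · intro k hk; simp only [Finset.mem_Icc] at hk; omega
      · intro k hk
        simp only [Finset.mem_Icc] at hk
        rw [Nat.cast_sub (by omega), show J(((m : ℕ) : ℤ) - k | m) = J(-(k : ℤ) | m) from
          jacobiSym_congr (by simp), jacobiSym_neg_of_three_mod_four (by omega),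
          eUnit_congr hm0 (a := -(l * (m - k))) (b := l * k) (by simp)]
        push_cast
        ring
    rw [charSum, hI, Finset.sum_insert (by simp), Finset.sum_union hdisj, hr]
    have : J(((0 : ℕ) : ℤ) | m) = 0 := by simpa using jacobiSym.zero_left (show 1 < m by omega)
    rw [this, ← Finset.sum_add_distrib]
    simp only [Int.cast_zero, zero_mul, zero_add]
    refine Finset.sum_congr rfl fun k _ => ?_
    ring
  rw [e1] at key
  simp_rw [eUnit_sub_eUnit_neg] at key
  have : Complex.I * (((J(l | m) : ℝ) * √(m : ℝ) : ℝ) : ℂ) = Complex.I *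
      ((2 * ∑ k ∈ Finset.Icc 1 (2 * t + 1), (J((k : ℤ) | m) : ℝ) *
        Real.sin (l * (2 * Real.pi * k / m)) : ℝ) : ℂ) := by
    push_cast at key ⊢
    rw [show Complex.I * ((J(l | m) : ℂ) * (√(m : ℝ) : ℝ)) =
      J(l | m) * (Complex.I * (√(m : ℝ) : ℝ)) by ring, ← key, Finset.mul_sum, Finset.mul_sum]
    refine Finset.sum_congr rfl fun k _ => ?_
    rw [show 2 * (Real.pi : ℂ) * (l * k / m) = l * (2 * Real.pi * k / m) by ring]
    ring
  exact_mod_cast mul_left_cancel₀ Complex.I_ne_zero this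

/-! ### Fourier series in odd frequencies -/

lemma hasSum_of_eq {β : Type*} {f g : β → ℂ} {a b : ℂ} (h : HasSum g b) (hfg : ∀ n, f n = g n)
    (hab : a = b) : HasSum f a := by
  rw [show f = g from funext hfg, hab]
  exact h

lemma odd_add_ne_zero (n : ℤ) {w : ℂ} (hw : ‖w‖ < 1) : (2 * n + 1 : ℂ) + w ≠ 0 := by
  intro h
  have h1 : w = ((-(2 * n + 1) : ℤ) : ℂ) := by push_cast; linear_combination h
  rw [h1, Complex.norm_intCast] at hw
  have h2 : |-(2 * n + 1)| < 1 := by exact_mod_cast hw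
  rw [Int.abs_lt_one_iff] at h2
  omega

lemma odd_sub_ne_zero (n : ℤ) {w : ℂ} (hw : ‖w‖ < 1) : (2 * n + 1 : ℂ) - w ≠ 0 := by
  rw [sub_eq_add_neg]
  exact odd_add_ne_zero n (by simpa using hw)

lemma odd_sq_sub_ne_zero (n : ℤ) {w : ℂ} (hw : ‖w‖ < 1) : (2 * n + 1 : ℂ) ^ 2 - w ^ 2 ≠ 0 := by
  rw [sq_sub_sq]
  exact mul_ne_zero (odd_add_ne_zero n hw) (odd_sub_ne_zero n hw)

lemma odd_ne_zero (n : ℤ) : (2 * n + 1 : ℂ) ≠ 0 := by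
  simpa using odd_add_ne_zero n (w := 0) (by simp)

lemma cos_pi_div_two_ne_zero {z : ℂ} (hz : ‖z‖ < 1) : Complex.cos (z * (Real.pi / 2)) ≠ 0 := by
  intro h
  obtain ⟨k, hk⟩ := Complex.cos_eq_zero_iff.mp h
  have hpi : (Real.pi : ℂ) ≠ 0 := by exact_mod_cast Real.pi_ne_zero
  have : (2 * k + 1 : ℂ) - z = 0 := by
    apply mul_left_cancel₀ hpi
    linear_combination -2 * hk
  exact odd_sub_ne_zero k hz this

lemma exp_odd_mul_pi (n : ℤ) (w : ℂ) :
    Complex.exp (-Complex.I * ((2 * n + 1) + w) * Real.pi) =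
      -Complex.exp (-Complex.I * w * Real.pi) := by
  have h : -Complex.I * ((2 * n + 1) + w) * Real.pi =
      -Complex.I * w * Real.pi + ((-n - 1 : ℤ) : ℂ) * (2 * Real.pi * Complex.I) +
        Real.pi * Complex.I := by push_cast; ring
  rw [h, Complex.exp_add_pi_mul_I, Complex.exp_add, Complex.exp_int_mul_two_pi_mul_I, mul_one]

lemma integral_exp_odd (n : ℤ) {w : ℂ} (hw : ‖w‖ < 1) :
    ∫ x in (0 : ℝ)..Real.pi, Complex.exp (-Complex.I * ((2 * n + 1) + w) * x) =
      (1 + Complex.exp (-Complex.I * w * Real.pi)) / (Complex.I * ((2 * n + 1) + w)) := by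
  have h0 := odd_add_ne_zero n hw
  rw [integral_exp_mul_complex (mul_ne_zero (neg_ne_zero.mpr Complex.I_ne_zero) h0),
    exp_odd_mul_pi]
  simp only [Complex.ofReal_zero, mul_zero, Complex.exp_zero, neg_mul, div_neg]
  ring

/-- Fourier expansion, on `[0, π)`, of a function that extends continuously to an antiperiodic
function with antiperiod `π`. -/
lemma hasSum_antiperiodic_fourier {f : ℝ → ℂ} (hf : Continuous f) (h0 : f Real.pi = -f 0)
    {c : ℤ → ℂ} (hc : Summable c)
    (hint : ∀ n : ℤ, ∫ x in (0 : ℝ)..Real.pi, Complex.exp (-Complex.I * (2 * n + 1) * x) * f x =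
      Real.pi * c n) {x : ℝ} (hx : x ∈ Set.Ico 0 Real.pi) :
    HasSum (fun n : ℤ => c n * Complex.exp (Complex.I * (2 * n + 1) * x)) (f x) := by
  have hpi : Fact (0 < Real.pi) := ⟨Real.pi_pos⟩
  have hpi0 : (Real.pi : ℂ) ≠ 0 := by exact_mod_cast Real.pi_ne_zero
  -- The twist by `exp(-ix)` makes an antiperiodic function `π`-periodic, and moves frequency `2n+1`
  -- of `f` to the `n`-th character of the circle of length `π`.
  set g : ℝ → ℂ := fun x => Complex.exp (-Complex.I * x) * f x with hg
  have hgc : Continuous g := by fun_prop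
  have hg0 : g 0 = g Real.pi := by
    simp only [hg, h0, Complex.ofReal_zero, mul_zero, Complex.exp_zero, one_mul]
    rw [neg_mul, mul_comm Complex.I, Complex.exp_neg, Complex.exp_pi_mul_I]
    norm_num
  let F : C(AddCircle Real.pi, ℂ) :=
    ⟨AddCircle.liftIco Real.pi 0 g, AddCircle.liftIco_zero_continuous hg0 hgc.continuousOn⟩
  have hcoef : ∀ n : ℤ, fourierCoeff F n = c n := by
    intro n
    change fourierCoeff (AddCircle.liftIco Real.pi 0 g) n = c n
    rw [fourierCoeff_liftIco_eq, fourierCoeffOn_eq_integral]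
    have : ∀ x : ℝ, fourier (-n) (x : AddCircle (0 + Real.pi - 0)) • g x =
        Complex.exp (-Complex.I * (2 * n + 1) * x) * f x := by
      intro x
      rw [fourier_coe_apply, smul_eq_mul, hg, ← mul_assoc, ← Complex.exp_add]
      congr 2
      push_cast
      rw [zero_add, sub_zero]
      field_simp
      ring
    simp_rw [this]
    rw [zero_add, sub_zero, hint, Complex.real_smul]
    push_cast
    field_simp
  have hs : Summable (fourierCoeff F) := by
    rw [show fourierCoeff F = c from funext hcoef]; exact hc
  have key := has_pointwise_sum_fourier_series_of_summable hs (x : AddCircle Real.pi)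
  have hFx : F (x : AddCircle Real.pi) = g x := by
    change AddCircle.liftIco Real.pi 0 g x = g x
    exact AddCircle.liftIco_zero_coe_apply hx
  rw [hFx] at key
  refine hasSum_of_eq (key.mul_left (Complex.exp (Complex.I * x))) (fun n => ?_) ?_
  · rw [hcoef, fourier_coe_apply, smul_eq_mul, mul_left_comm, ← Complex.exp_add]
    congr 2
    field_simp
    ring
  · rw [hg, ← mul_assoc, ← Complex.exp_add]
    simp

lemma norm_two_mul_add_one (j : ℕ) : ‖(2 * j + 1 : ℂ)‖ = 2 * j + 1 := by
  rw [show (2 * j + 1 : ℂ) = ((2 * j + 1 : ℕ) : ℂ) by push_cast; ring, Complex.norm_natCast]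
  push_cast; ring

lemma norm_odd_sq_sub_ge (n : ℕ) {z : ℂ} (hz : ‖z‖ < 1) :
    (1 - ‖z‖ ^ 2) * (n + 1 : ℝ) ^ 2 ≤ ‖(2 * n + 1 : ℂ) ^ 2 - z ^ 2‖ := by
  have h1 : ‖(2 * n + 1 : ℂ) ^ 2‖ - ‖z ^ 2‖ ≤ ‖(2 * n + 1 : ℂ) ^ 2 - z ^ 2‖ := norm_sub_norm_le _ _
  rw [norm_pow, norm_pow, norm_two_mul_add_one] at h1
  have h3 : (0 : ℝ) ≤ n := n.cast_nonneg
  have h4 : 0 ≤ ‖z‖ := norm_nonneg z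
  have h5 : ‖z‖ ^ 2 ≤ 1 := by nlinarith
  nlinarith [mul_nonneg (sq_nonneg ‖z‖) h3, sq_nonneg (n : ℝ)]

lemma summable_inv_odd_sq_sub {z : ℂ} (hz : ‖z‖ < 1) :
    Summable fun n : ℕ => ((2 * n + 1 : ℂ) ^ 2 - z ^ 2)⁻¹ := by
  have hpos : 0 < 1 - ‖z‖ ^ 2 := by nlinarith [norm_nonneg z]
  have hs : Summable fun n : ℕ => (1 - ‖z‖ ^ 2)⁻¹ * ((n + 1 : ℝ) ^ 2)⁻¹ := by
    refine Summable.mul_left _ ?_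
    have := (summable_nat_add_iff 1).mpr (Real.summable_nat_pow_inv.mpr (by norm_num : 1 < 2))
    simpa using this
  refine hs.of_norm_bounded fun n => ?_
  rw [norm_inv, ← mul_inv]
  exact inv_anti₀ (by positivity) (norm_odd_sq_sub_ge n hz)

lemma summable_int_inv_odd_sq_sub {z : ℂ} (hz : ‖z‖ < 1) :
    Summable fun n : ℤ => ((2 * n + 1 : ℂ) ^ 2 - z ^ 2)⁻¹ := by
  refine Summable.of_nat_of_neg_add_one ?_ ?_
  · simpa using summable_inv_odd_sq_sub hz
  · convert summable_inv_odd_sq_sub hz using 3 with n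
    push_cast
    ring

/-- The factor `exp(izπ/2)` symmetrizes `1 + exp(-izπ)` into `2 cos(zπ/2)`, which is even in `z`;
the terms for `z` and `-z` can then be combined. -/
lemma integral_exp_odd_mul_exp_mul_exp (n : ℤ) {z : ℂ} (hz : ‖z‖ < 1) (C : ℂ) :
    ∫ x in (0 : ℝ)..Real.pi, C * Complex.exp (-Complex.I * ((2 * n + 1) + z) * x) *
      Complex.exp (Complex.I * z * (Real.pi / 2)) =
      C * (2 * Complex.cos (z * (Real.pi / 2))) / (Complex.I * ((2 * n + 1) + z)) := by
  rw [intervalIntegral.integral_mul_const, intervalIntegral.integral_const_mul,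
    integral_exp_odd n hz, Complex.two_cos]
  have h1 : Complex.exp (-Complex.I * z * Real.pi) * Complex.exp (Complex.I * z * (Real.pi / 2)) =
      Complex.exp (-(z * (Real.pi / 2)) * Complex.I) := by
    rw [← Complex.exp_add]; ring_nf
  rw [← h1, show z * ((Real.pi : ℂ) / 2) * Complex.I = Complex.I * z * (Real.pi / 2) by ring]
  ring

lemma exp_mul_exp_mul_exp (l z w : ℂ) (x : ℝ) :
    Complex.exp (-Complex.I * (l + z) * x) * Complex.exp (Complex.I * z * w) =
      Complex.exp (-Complex.I * l * x) * Complex.exp (z * (w - x) * Complex.I) := by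
  rw [← Complex.exp_add, ← Complex.exp_add]
  ring_nf

lemma integral_exp_odd_mul_sin (n : ℤ) {z : ℂ} (hz : ‖z‖ < 1) :
    ∫ x in (0 : ℝ)..Real.pi, Complex.exp (-Complex.I * (2 * n + 1) * x) *
        Complex.sin (z * (Real.pi / 2 - x)) =
      Real.pi * (2 / Real.pi * Complex.cos (z * (Real.pi / 2)) * z *
        ((2 * n + 1 : ℂ) ^ 2 - z ^ 2)⁻¹) := by
  have hz' : ‖-z‖ < 1 := by simpa using hz
  have hpi : (Real.pi : ℂ) ≠ 0 := by exact_mod_cast Real.pi_ne_zero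
  have hpt : ∀ x : ℝ, Complex.exp (-Complex.I * (2 * n + 1) * x) *
        Complex.sin (z * (Real.pi / 2 - x)) =
      Complex.I / 2 * Complex.exp (-Complex.I * ((2 * n + 1) + -z) * x) *
          Complex.exp (Complex.I * -z * (Real.pi / 2)) -
        Complex.I / 2 * Complex.exp (-Complex.I * ((2 * n + 1) + z) * x) *
          Complex.exp (Complex.I * z * (Real.pi / 2)) := by
    intro x
    rw [mul_assoc (Complex.I / 2), mul_assoc (Complex.I / 2), exp_mul_exp_mul_exp,
      exp_mul_exp_mul_exp, Complex.sin, neg_mul z]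
    ring
  simp_rw [hpt]
  rw [intervalIntegral.integral_sub, integral_exp_odd_mul_exp_mul_exp n hz',
    integral_exp_odd_mul_exp_mul_exp n hz, neg_mul z, Complex.cos_neg]
  · have h1 := odd_add_ne_zero n hz
    have h2 := odd_sub_ne_zero n hz
    rw [sq_sub_sq, ← sub_eq_add_neg]
    field_simp
    ring
  · exact Continuous.intervalIntegrable (by fun_prop) _ _
  · exact Continuous.intervalIntegrable (by fun_prop) _ _

lemma integral_exp_odd_mul_cos_sub (n : ℤ) {z : ℂ} (hz : ‖z‖ < 1) :
    ∫ x in (0 : ℝ)..Real.pi, Complex.exp (-Complex.I * (2 * n + 1) * x) *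
        (Complex.cos (z * (Real.pi / 2 - x)) - Complex.cos (z * (Real.pi / 2))) =
      Real.pi * (2 / (Real.pi * Complex.I) * Complex.cos (z * (Real.pi / 2)) * z ^ 2 *
        ((2 * n + 1 : ℂ)⁻¹ * ((2 * n + 1 : ℂ) ^ 2 - z ^ 2)⁻¹)) := by
  have hz' : ‖-z‖ < 1 := by simpa using hz
  have hpi : (Real.pi : ℂ) ≠ 0 := by exact_mod_cast Real.pi_ne_zero
  -- The subtracted constant is written as the case `z = 0`, so that one integral formula serves all
  -- three terms.
  have hpt : ∀ x : ℝ, Complex.exp (-Complex.I * (2 * n + 1) * x) *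
        (Complex.cos (z * (Real.pi / 2 - x)) - Complex.cos (z * (Real.pi / 2))) =
      1 / 2 * Complex.exp (-Complex.I * ((2 * n + 1) + -z) * x) *
          Complex.exp (Complex.I * -z * (Real.pi / 2)) +
        1 / 2 * Complex.exp (-Complex.I * ((2 * n + 1) + z) * x) *
          Complex.exp (Complex.I * z * (Real.pi / 2)) -
        Complex.cos (z * (Real.pi / 2)) * Complex.exp (-Complex.I * ((2 * n + 1) + 0) * x) *
          Complex.exp (Complex.I * 0 * (Real.pi / 2)) := by
    intro x
    rw [mul_assoc (1 / 2), mul_assoc (1 / 2), exp_mul_exp_mul_exp,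
      exp_mul_exp_mul_exp, neg_mul z]
    have h2 := Complex.two_cos (z * (Real.pi / 2 - x))
    simp only [mul_zero, zero_mul, Complex.exp_zero, add_zero]
    linear_combination Complex.exp (-Complex.I * (2 * n + 1) * x) / 2 * h2
  simp_rw [hpt]
  rw [intervalIntegral.integral_sub, intervalIntegral.integral_add,
    integral_exp_odd_mul_exp_mul_exp n hz', integral_exp_odd_mul_exp_mul_exp n hz,
    integral_exp_odd_mul_exp_mul_exp n (z := 0) (by simp), neg_mul z, Complex.cos_neg]
  · have h1 := odd_add_ne_zero n hz
    have h2 := odd_sub_ne_zero n hz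
    have h3 := odd_ne_zero n
    rw [sq_sub_sq, ← sub_eq_add_neg, add_zero, zero_mul, Complex.cos_zero]
    field_simp
    ring
  all_goals exact Continuous.intervalIntegrable (by fun_prop) _ _

lemma hasSum_cos_odd {z : ℂ} (hz : ‖z‖ < 1) {x : ℝ} (hx : x ∈ Set.Ico 0 Real.pi) :
    HasSum (fun n : ℕ => 4 / (Real.pi : ℂ) * z * (Complex.cos ((2 * n + 1) * x) *
        ((2 * n + 1 : ℂ) ^ 2 - z ^ 2)⁻¹))
      (Complex.sin (z * (Real.pi / 2 - x)) / Complex.cos (z * (Real.pi / 2))) := by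
  have hc0 := cos_pi_div_two_ne_zero hz
  have key := (hasSum_antiperiodic_fourier
    (f := fun x : ℝ => Complex.sin (z * (Real.pi / 2 - x))) (by fun_prop) (by
      simp only [Complex.ofReal_zero, sub_zero]
      rw [← Complex.sin_neg]
      ring_nf)
    ((summable_int_inv_odd_sq_sub hz).mul_left _)
    (fun n => integral_exp_odd_mul_sin n hz) hx).nat_add_neg_add_one
  refine hasSum_of_eq (key.div_const (Complex.cos (z * (Real.pi / 2)))) (fun n => ?_) rfl
  push_cast
  rw [show (2 * -((n : ℂ) + 1) + 1) = -(2 * n + 1) by ring, neg_sq, Complex.cos,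
    show Complex.I * -(2 * (n : ℂ) + 1) * x = -((2 * n + 1) * x) * Complex.I by ring,
    show Complex.I * (2 * (n : ℂ) + 1) * x = (2 * n + 1) * x * Complex.I by ring,
    eq_div_iff hc0]
  ring

/-- The cosine takes equal values at `0` and `π`, so its antiperiodic extension jumps. Subtracting
`cos(zπ/2)` removes the jump and makes the coefficients summable; the constant is restored later by
the square wave. -/
lemma hasSum_sin_odd {z : ℂ} (hz : ‖z‖ < 1) {x : ℝ} (hx : x ∈ Set.Ico 0 Real.pi) :
    HasSum (fun n : ℕ => 4 / (Real.pi : ℂ) * z ^ 2 * (Complex.sin ((2 * n + 1) * x) *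
        ((2 * n + 1 : ℂ)⁻¹ * ((2 * n + 1 : ℂ) ^ 2 - z ^ 2)⁻¹)))
      (Complex.cos (z * (Real.pi / 2 - x)) / Complex.cos (z * (Real.pi / 2)) - 1) := by
  have hc0 := cos_pi_div_two_ne_zero hz
  have hs : Summable fun n : ℤ => (2 * n + 1 : ℂ)⁻¹ * ((2 * n + 1 : ℂ) ^ 2 - z ^ 2)⁻¹ := by
    refine (summable_int_inv_odd_sq_sub hz).norm.of_norm_bounded fun n => ?_
    rw [norm_mul]
    refine mul_le_of_le_one_left (norm_nonneg _) ?_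
    rw [norm_inv]
    apply inv_le_one_of_one_le₀
    rw [show (2 * n + 1 : ℂ) = ((2 * n + 1 : ℤ) : ℂ) by push_cast; ring, Complex.norm_intCast]
    exact_mod_cast Int.one_le_abs (by omega)
  have key := (hasSum_antiperiodic_fourier
    (f := fun x : ℝ => Complex.cos (z * (Real.pi / 2 - x)) - Complex.cos (z * (Real.pi / 2)))
    (by fun_prop) (by
      simp only [Complex.ofReal_zero, sub_zero, sub_self, neg_zero]
      rw [← Complex.cos_neg, sub_eq_zero]
      ring_nf)
    (hs.mul_left _)
    (fun n => integral_exp_odd_mul_cos_sub n hz) hx).nat_add_neg_add_one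
  refine hasSum_of_eq (key.div_const (Complex.cos (z * (Real.pi / 2)))) (fun n => ?_) ?_
  · push_cast
    rw [show (2 * -((n : ℂ) + 1) + 1) = -(2 * n + 1) by ring, neg_sq, Complex.sin,
      show Complex.I * -(2 * (n : ℂ) + 1) * x = -((2 * n + 1) * x) * Complex.I by ring,
      show Complex.I * (2 * (n : ℂ) + 1) * x = (2 * n + 1) * x * Complex.I by ring, inv_neg,
      ← div_div, Complex.div_I, eq_div_iff hc0]
    ring
  · rw [sub_div, div_self hc0]

/-! ### The conditionally convergent square wave -/

/-- The value of the square wave: `∑ sin (l θ) / l = π / 4` over odd `l`, for `0 < θ < π`. -/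
lemma tendsto_sum_sin_odd_div {x : ℝ} (hx : x ∈ Set.Ioo 0 Real.pi) :
    Tendsto (fun N => ∑ n ∈ Finset.range N, Real.sin ((2 * n + 1) * x) / (2 * n + 1)) atTop
      (𝓝 (Real.pi / 4)) := by
  set w : ℂ := Complex.exp (x * Complex.I) with hw
  have hwn : ‖w‖ = 1 := Complex.norm_exp_ofReal_mul_I x
  have hsin : 0 < Real.sin x := Real.sin_pos_of_mem_Ioo hx
  have hwim : w.im = Real.sin x := Complex.exp_ofReal_mul_I_im x
  have hw2 : w ^ 2 - 1 ≠ 0 := by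
    intro h
    rcases sq_eq_sq_iff_eq_or_eq_neg.mp ((sub_eq_zero.mp h).trans (one_pow 2).symm) with h | h <;>
    · rw [h] at hwim; simp at hwim; exact hsin.ne hwim
  -- convergence of the exponential series, by Dirichlet's test
  have hconv : ∃ S : ℂ, Tendsto (fun N => ∑ n ∈ Finset.range N, w ^ (2 * n + 1) / (2 * n + 1 : ℕ))
      atTop (𝓝 S) := by
    have hanti : Antitone fun n : ℕ => ((2 * n + 1 : ℕ) : ℝ)⁻¹ := fun a b hab =>
      inv_anti₀ (by positivity) (by exact_mod_cast (by omega : 2 * a + 1 ≤ 2 * b + 1))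
    have hlim : Tendsto (fun n : ℕ => ((2 * n + 1 : ℕ) : ℝ)⁻¹) atTop (𝓝 0) :=
      tendsto_inv_atTop_zero.comp (tendsto_natCast_atTop_atTop.comp
        (tendsto_atTop_mono (fun n => by simp; omega) tendsto_id))
    have hb : ∀ N, ‖∑ n ∈ Finset.range N, w ^ (2 * n + 1)‖ ≤ 2 / ‖w ^ 2 - 1‖ := by
      intro N
      have : ∑ n ∈ Finset.range N, w ^ (2 * n + 1) = w * (((w ^ 2) ^ N - 1) / (w ^ 2 - 1)) := by
        rw [← geom_sum_eq (sub_ne_zero.mp hw2), Finset.mul_sum]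
        exact Finset.sum_congr rfl fun n _ => by ring
      rw [this, norm_mul, hwn, one_mul, norm_div]
      gcongr
      refine (norm_sub_le _ _).trans ?_
      simp [hwn]
      norm_num
    obtain ⟨S, hS⟩ := cauchySeq_tendsto_of_complete
      (hanti.cauchySeq_series_mul_of_tendsto_zero_of_bounded hlim hb)
    refine ⟨S, hS.congr fun N => Finset.sum_congr rfl fun n _ => ?_⟩
    rw [Complex.real_smul]
    push_cast
    ring
  obtain ⟨S, hS⟩ := hconv
  have h1 : 1 - w ≠ 0 := fun h => hw2 (by linear_combination (-(1 + w)) * h)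
  have hdiv : (1 + w) / (1 - w) =
      ((2 * Real.sin x / Complex.normSq (1 - w) : ℝ) : ℂ) * Complex.I := by
    have h2 : (1 + w) * (starRingEnd ℂ) (1 - w) = 2 * Real.sin x * Complex.I := by
      have h3 : w * (starRingEnd ℂ) w = 1 := by
        rw [Complex.mul_conj, Complex.normSq_eq_norm_sq, hwn]; simp
      have h4 := Complex.sub_conj w
      rw [hwim] at h4
      push_cast at h4 ⊢
      rw [map_sub, map_one]
      linear_combination h4 - h3
    have h5 : (1 - w) * (starRingEnd ℂ) (1 - w) = Complex.normSq (1 - w) := Complex.mul_conj _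
    have h6 : (Complex.normSq (1 - w) : ℂ) ≠ 0 := by
      exact_mod_cast (Complex.normSq_pos.mpr h1).ne'
    push_cast at h2 ⊢
    rw [div_eq_iff h1, div_mul_eq_mul_div, div_mul_eq_mul_div, eq_div_iff h6, ← h5]
    linear_combination (1 - w) * h2
  -- For `w` on the open upper half of the unit circle `(1+w)/(1-w)` is a positive multiple of `i`;
  -- half of its argument is the limit `π/4`.
  have harg : ((1 + w) / (1 - w)).arg = Real.pi / 2 := by
    have h2 := Complex.normSq_pos.mpr h1
    rw [hdiv, Complex.arg_eq_pi_div_two_iff]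
    simp
    positivity
  have hlog : Tendsto (fun r : ℝ => 1 / 2 * Complex.log ((1 + r * w) / (1 - r * w))) (𝓝[<] 1)
      (𝓝 (1 / 2 * Complex.log ((1 + w) / (1 - w)))) := by
    have hc : ContinuousAt (fun r : ℝ => 1 / 2 * Complex.log ((1 + r * w) / (1 - r * w))) 1 := by
      refine ContinuousAt.mul continuousAt_const (ContinuousAt.clog ?_ ?_)
      · refine ContinuousAt.div (by fun_prop) (by fun_prop) (by simpa using h1)
      · rw [Complex.ofReal_one, one_mul, Complex.mem_slitPlane_iff_arg]
        refine ⟨by rw [harg]; linarith [Real.pi_pos], fun h => ?_⟩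
        rw [h, Complex.arg_zero] at harg
        linarith [Real.pi_pos]
    simpa using hc.tendsto.mono_left nhdsWithin_le_nhds
  have abel := Complex.tendsto_tsum_powerSeries_nhdsWithin_lt hS
  rw [tendsto_map'_iff] at abel
  -- The odd series at `r w` is `r` times a power series in `r²`, so Abel's theorem is applied at
  -- `r²`.
  have hsq : Tendsto (fun r : ℝ => r ^ 2) (𝓝[<] 1) (𝓝[<] 1) := by
    apply tendsto_nhdsWithin_of_tendsto_nhds_of_eventually_within
    · have : ContinuousAt (fun r : ℝ => r ^ 2) 1 := by fun_prop
      simpa using this.tendsto.mono_left nhdsWithin_le_nhds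
    · filter_upwards [Ioo_mem_nhdsLT (zero_lt_one (α := ℝ))] with r hr
      exact pow_lt_one₀ hr.1.le hr.2 two_ne_zero
  have hid : Tendsto (fun r : ℝ => (r : ℂ)) (𝓝[<] 1) (𝓝 1) := by
    have : ContinuousAt (fun r : ℝ => (r : ℂ)) 1 := by fun_prop
    simpa using this.tendsto.mono_left nhdsWithin_le_nhds
  have habel := hid.mul (abel.comp hsq)
  rw [one_mul] at habel
  have hSeq : S = 1 / 2 * Complex.log ((1 + w) / (1 - w)) := by
    refine tendsto_nhds_unique habel (hlog.congr' ?_)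
    filter_upwards [Ioo_mem_nhdsLT (zero_lt_one (α := ℝ))] with r hr
    -- Inside the disc, `½ log((1+rw)/(1-rw))` is `i arctan(-i r w)`, whose Taylor series is
    -- available.
    have hn : ‖-Complex.I * (r * w)‖ < 1 := by
      simp [hwn, abs_of_pos hr.1, hr.2]
    have hat := (Complex.hasSum_arctan hn).mul_left Complex.I
    rw [Complex.arctan, show -Complex.I * (r * w) * Complex.I = r * w by
      linear_combination (-(r * w)) * Complex.I_sq] at hat
    have hval : Complex.I * (-Complex.I / 2 * Complex.log ((1 + r * w) / (1 - r * w))) =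
        1 / 2 * Complex.log ((1 + r * w) / (1 - r * w)) := by
      linear_combination (-(1 / 2 * Complex.log ((1 + r * w) / (1 - r * w)))) * Complex.I_sq
    rw [← hval, ← hat.tsum_eq, Function.comp_apply, Function.comp_apply, ← tsum_mul_left]
    refine tsum_congr fun n => ?_
    have hI : Complex.I * ((-1) ^ n * (-Complex.I) ^ (2 * n + 1)) = 1 := by
      rw [pow_succ, pow_mul, neg_sq, Complex.I_sq]
      have : ((-1 : ℂ) ^ n) * (-1) ^ n = 1 := by rw [← mul_pow]; simp
      linear_combination (-(Complex.I * Complex.I)) * this - Complex.I_sq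
    rw [mul_pow (-Complex.I), mul_pow (r : ℂ)]
    push_cast
    rw [← pow_mul, pow_succ (r : ℂ)]
    linear_combination (r ^ (2 * n) * r * w ^ (2 * n + 1) / (2 * n + 1 : ℂ)) * hI
  have him : S.im = Real.pi / 4 := by
    rw [hSeq, show (1 / 2 : ℂ) = ((1 / 2 : ℝ) : ℂ) by push_cast; ring, Complex.im_ofReal_mul,
      Complex.log_im, harg]
    ring
  have hfin := (Complex.continuous_im.tendsto S).comp hS
  rw [him] at hfin
  refine hfin.congr fun N => ?_
  rw [Function.comp_apply, Complex.im_sum]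
  refine Finset.sum_congr rfl fun n _ => ?_
  have hpow : w ^ (2 * n + 1) = Complex.exp (((2 * n + 1) * x : ℝ) * Complex.I) := by
    rw [hw, ← Complex.exp_nat_mul]
    push_cast
    ring_nf
  rw [Complex.div_natCast_im, hpow, Complex.exp_ofReal_mul_I_im]
  push_cast
  ring

/-! ### From Fourier series to power series in `z` -/

lemma summable_div_odd_pow {a : ℕ → ℂ} (ha : ∀ j, ‖a j‖ ≤ 1) (e : ℕ) :
    Summable fun j : ℕ => a j / (2 * j + 1 : ℂ) ^ (e + 2) := by
  have hs : Summable fun n : ℕ => ((n + 1 : ℝ) ^ 2)⁻¹ := by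
    have := (summable_nat_add_iff 1).mpr (Real.summable_nat_pow_inv.mpr (by norm_num : 1 < 2))
    simpa using this
  refine hs.of_norm_bounded fun j => ?_
  rw [norm_div, norm_pow, norm_two_mul_add_one, ← one_div]
  refine div_le_div₀ zero_le_one (ha j) (by positivity) ?_
  have hj : (0 : ℝ) ≤ j := j.cast_nonneg
  calc ((j : ℝ) + 1) ^ 2 ≤ (2 * (j : ℝ) + 1) ^ 2 := by gcongr; linarith
    _ ≤ (2 * (j : ℝ) + 1) ^ (e + 2) := pow_le_pow_right₀ (by linarith) (by omega)

lemma hasSum_pow_div_odd_pow {z : ℂ} (hz : ‖z‖ < 1) (j e : ℕ) :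
    HasSum (fun n : ℕ => z ^ (2 * n) * ((2 * j + 1 : ℂ) ^ (2 * n + e + 2))⁻¹)
      (((2 * j + 1 : ℂ) ^ e)⁻¹ * ((2 * j + 1 : ℂ) ^ 2 - z ^ 2)⁻¹) := by
  have hl0 : (2 * j + 1 : ℂ) ≠ 0 := by simpa using odd_ne_zero j
  have hd := odd_sq_sub_ne_zero j hz
  rw [Int.cast_natCast] at hd
  have hr : ‖(z / (2 * j + 1 : ℂ)) ^ 2‖ < 1 := by
    rw [norm_pow, norm_div, norm_two_mul_add_one]
    refine pow_lt_one₀ (by positivity) ?_ two_ne_zero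
    rw [div_lt_one (by positivity)]
    linarith [(j.cast_nonneg : (0 : ℝ) ≤ j)]
  generalize (2 * j + 1 : ℂ) = l at *
  refine hasSum_of_eq ((hasSum_geometric_of_norm_lt_one hr).mul_left
    (l ^ (e + 2))⁻¹) (fun n => ?_) ?_
  · rw [div_pow, div_pow, ← pow_mul, ← pow_mul, show 2 * n + e + 2 = 2 * n + (e + 2) by ring,
      pow_add _ (2 * n) (e + 2), mul_inv]
    ring
  · have : 1 - (z / l) ^ 2 = (l ^ 2 - z ^ 2) / l ^ 2 := by
      field_simp
    rw [this, pow_add, inv_div, mul_inv]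
    field_simp

lemma hasSum_of_hasSum_fiberwise {F : ℕ × ℕ → ℂ} (hF : Summable F) {r c : ℕ → ℂ} {v : ℂ}
    (hr : ∀ n, HasSum (fun j => F (n, j)) (r n)) (hc : ∀ j, HasSum (fun n => F (n, j)) (c j))
    (hv : HasSum c v) : HasSum r v := by
  have hswap : HasSum (fun p : ℕ × ℕ => F (p.2, p.1)) (∑' p, F p) :=
    (Equiv.prodComm ℕ ℕ).hasSum_iff.mpr hF.hasSum
  rw [← (hswap.prod_fiberwise hc).unique hv]
  exact hF.hasSum.prod_fiberwise hr

lemma summable_pow_mul_div_odd_pow {a : ℕ → ℂ} (ha : ∀ j, ‖a j‖ ≤ 1) {z : ℂ} (hz : ‖z‖ < 1)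
    (e : ℕ) :
    Summable fun p : ℕ × ℕ =>
      z ^ (2 * p.1) * (a p.2 / (2 * (p.2 : ℂ) + 1) ^ (2 * p.1 + e + 2)) := by
  have h1 : Summable fun n : ℕ => (‖z‖ ^ 2) ^ n :=
    summable_geometric_of_lt_one (by positivity) (pow_lt_one₀ (norm_nonneg z) hz two_ne_zero)
  have h2 := (summable_div_odd_pow ha e).norm
  refine (h1.mul_of_nonneg h2 (fun n => by positivity) (fun j => norm_nonneg _)).of_norm_bounded ?_
  rintro ⟨n, j⟩
  have hj : (0 : ℝ) ≤ j := j.cast_nonneg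
  rw [norm_mul, norm_pow, pow_mul]
  refine mul_le_mul_of_nonneg_left ?_ (by positivity)
  rw [norm_div, norm_div, norm_pow, norm_pow, norm_two_mul_add_one]
  refine div_le_div_of_nonneg_left (norm_nonneg _) (by positivity) ?_
  exact pow_le_pow_right₀ (by linarith) (by omega)

/-- Interchange of summation between the powers of `z` and the odd integers. -/
lemma hasSum_pow_mul_tsum_div_odd_pow {a : ℕ → ℂ} (ha : ∀ j, ‖a j‖ ≤ 1) {z : ℂ} (hz : ‖z‖ < 1)
    (e : ℕ) {v : ℂ}
    (hv : HasSum (fun j : ℕ => a j * (((2 * j + 1 : ℂ) ^ e)⁻¹ *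
      ((2 * j + 1 : ℂ) ^ 2 - z ^ 2)⁻¹)) v) :
    HasSum (fun n : ℕ => z ^ (2 * n) * ∑' j : ℕ, a j / (2 * j + 1 : ℂ) ^ (2 * n + e + 2)) v := by
  refine hasSum_of_hasSum_fiberwise (summable_pow_mul_div_odd_pow ha hz e) (fun n => ?_)
    (fun j => ?_) hv
  · exact (summable_div_odd_pow ha (2 * n + e)).hasSum.mul_left (z ^ (2 * n))
  · refine hasSum_of_eq ((hasSum_pow_div_odd_pow hz j e).mul_left (a j)) (fun n => ?_) rfl
    ring

lemma ofReal_eq_tsum_of_tendsto {a : ℕ → ℝ} (ha : ∀ j, |a j| ≤ 1) (e : ℕ) {B : ℝ}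
    (hB : Tendsto (fun N => ∑ j ∈ Finset.range N, a j / (2 * j + 1 : ℝ) ^ (e + 2)) atTop (𝓝 B)) :
    (B : ℂ) = ∑' j : ℕ, (a j : ℂ) / (2 * j + 1 : ℂ) ^ (e + 2) := by
  have h1 := (summable_div_odd_pow (a := fun j => (a j : ℂ)) (fun j => by simpa using ha j)
    e).hasSum.tendsto_sum_nat
  refine tendsto_nhds_unique ?_ h1
  refine ((Complex.continuous_ofReal.tendsto B).comp hB).congr fun N => ?_
  simp

lemma exists_tendsto_sum_div_odd_pow {a : ℕ → ℝ} (ha : ∀ j, |a j| ≤ 1) (e : ℕ) :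
    ∃ B, Tendsto (fun N => ∑ j ∈ Finset.range N, a j / (2 * j + 1 : ℝ) ^ (e + 2)) atTop (𝓝 B) := by
  have h1 := (summable_div_odd_pow (a := fun j => (a j : ℂ)) (fun j => by simpa using ha j) e)
  have h2 : Summable fun j : ℕ => a j / (2 * j + 1 : ℝ) ^ (e + 2) := by
    refine Complex.summable_ofReal.mp (h1.congr fun j => ?_)
    push_cast
    rfl
  exact ⟨_, h2.hasSum.tendsto_sum_nat⟩

/-- The terms `n ≥ 1` come from `hasSum_sin_odd` by interchanging an absolutely convergent double
sum; the term `n = 0` is the square wave and supplies the missing 1. The hypothesis speaks of limits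
of partial sums because the series for `n = 0` is not absolutely convergent. -/
lemma hasSum_pow_even {θ : ℝ} (hθ : θ ∈ Set.Ioo 0 Real.pi) {B : ℕ → ℝ}
    (hB : ∀ n, Tendsto (fun N => ∑ j ∈ Finset.range N,
      Real.sin ((2 * j + 1) * θ) / (2 * j + 1 : ℝ) ^ (2 * n + 1)) atTop (𝓝 (B n)))
    {z : ℂ} (hz : ‖z‖ < 1) :
    HasSum (fun n : ℕ => 4 / (Real.pi : ℂ) * B n * z ^ (2 * n))
      (Complex.cos (z * (Real.pi / 2 - θ)) / Complex.cos (z * (Real.pi / 2))) := by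
  have hpi : (Real.pi : ℂ) ≠ 0 := by exact_mod_cast Real.pi_ne_zero
  have hB0 : B 0 = Real.pi / 4 := by
    refine tendsto_nhds_unique (hB 0) ?_
    simpa using tendsto_sum_sin_odd_div hθ
  have hs := hasSum_sin_odd hz (Set.Ioo_subset_Ico_self hθ)
  -- The interchange is done after division by `z²`.
  by_cases hz0 : z = 0
  · subst hz0
    refine hasSum_of_eq (hasSum_single 0 ?_ : HasSum (fun n : ℕ => 4 / (Real.pi : ℂ) * B n *
      0 ^ (2 * n)) _) (fun _ => rfl) ?_
    · intro n hn
      simp [hn]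
    · rw [hB0]
      push_cast
      simp
  have hC : 4 / (Real.pi : ℂ) * z ^ 2 ≠ 0 := by
    refine mul_ne_zero (div_ne_zero (by norm_num) hpi) (pow_ne_zero 2 hz0)
  have hs2 := hs.div_const (4 / (Real.pi : ℂ) * z ^ 2)
  simp_rw [mul_div_cancel_left₀ _ hC] at hs2
  have hsw := hasSum_pow_mul_tsum_div_odd_pow
    (a := fun j => ((Real.sin ((2 * j + 1) * θ) : ℝ) : ℂ))
    (fun j => by rw [Complex.norm_real]; exact Real.abs_sin_le_one _) hz 1
    (hasSum_of_eq hs2 (fun n => by push_cast; rw [pow_one]) rfl)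
  have htail := hsw.mul_left (4 / (Real.pi : ℂ) * z ^ 2)
  rw [mul_div_cancel₀ _ hC] at htail
  rw [← hasSum_nat_add_iff' 1]
  refine hasSum_of_eq htail (fun n => ?_) ?_
  · have := ofReal_eq_tsum_of_tendsto (a := fun j => Real.sin ((2 * j + 1) * θ))
      (fun j => Real.abs_sin_le_one _) (2 * n + 1) (hB (n + 1))
    rw [this]
    ring
  · rw [Finset.sum_range_one, hB0]
    push_cast
    field_simp

lemma hasSum_pow_odd {φ : ℝ} (hφ : φ ∈ Set.Ico 0 Real.pi) {C : ℕ → ℝ}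
    (hC : ∀ n, Tendsto (fun N => ∑ j ∈ Finset.range N,
      Real.cos ((2 * j + 1) * φ) / (2 * j + 1 : ℝ) ^ (2 * n + 2)) atTop (𝓝 (C n)))
    {z : ℂ} (hz : ‖z‖ < 1) :
    HasSum (fun n : ℕ => 4 / (Real.pi : ℂ) * C n * z ^ (2 * n + 1))
      (Complex.sin (z * (Real.pi / 2 - φ)) / Complex.cos (z * (Real.pi / 2))) := by
  have hpi : (Real.pi : ℂ) ≠ 0 := by exact_mod_cast Real.pi_ne_zero
  have hs := hasSum_cos_odd hz hφ
  by_cases hz0 : z = 0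
  · subst hz0
    simp
  have hK : 4 / (Real.pi : ℂ) * z ≠ 0 := mul_ne_zero (div_ne_zero (by norm_num) hpi) hz0
  have hs2 := hs.div_const (4 / (Real.pi : ℂ) * z)
  simp_rw [mul_div_cancel_left₀ _ hK] at hs2
  have hsw := hasSum_pow_mul_tsum_div_odd_pow
    (a := fun j => ((Real.cos ((2 * j + 1) * φ) : ℝ) : ℂ))
    (fun j => by rw [Complex.norm_real]; exact Real.abs_cos_le_one _) hz 0
    (hasSum_of_eq hs2 (fun n => by push_cast; rw [pow_zero, inv_one, one_mul]) rfl)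
  have htail := hsw.mul_left (4 / (Real.pi : ℂ) * z)
  rw [mul_div_cancel₀ _ hK] at htail
  refine hasSum_of_eq htail (fun n => ?_) rfl
  have := ofReal_eq_tsum_of_tendsto (a := fun j => Real.cos ((2 * j + 1) * φ))
    (fun j => Real.abs_cos_le_one _) (2 * n) (hC n)
  rw [this]
  ring

/-! ### Reciprocity and the Dirichlet series -/

lemma sum_filter_odd_range (f : ℕ → ℝ) (N : ℕ) :
    ∑ l ∈ (Finset.range N).filter Odd, f l = ∑ j ∈ Finset.range (N / 2), f (2 * j + 1) := by
  symm
  refine Finset.sum_bij' (fun j _ => 2 * j + 1) (fun l _ => l / 2) ?_ ?_ ?_ ?_ ?_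
  · intro j hj
    simp only [Finset.mem_range, Finset.mem_filter, Nat.odd_iff] at hj ⊢
    omega
  · intro l hl
    simp only [Finset.mem_range, Finset.mem_filter, Nat.odd_iff] at hl ⊢
    omega
  · intro j _
    omega
  · intro l hl
    simp only [Finset.mem_range, Finset.mem_filter, Nat.odd_iff] at hl
    omega
  · intro j _
    rfl

lemma jacobiSym_odd_eq {m : ℕ} (hm : m % 4 = 3) (j : ℕ) :
    J((m : ℤ) | 2 * j + 1) = (-1) ^ j * J(((2 * j + 1 : ℕ) : ℤ) | m) := by
  rw [jacobiSym.quadratic_reciprocity (by rw [Nat.odd_iff]; omega) (by simp),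
    show (2 * j + 1) / 2 = j by omega, pow_mul, Odd.neg_one_pow (by rw [Nat.odd_iff]; omega)]

/-- The sign `(-1)^j` from reciprocity cancels against the symbol of `-1` modulo `2j+1`. -/
lemma jacobiSym_neg_odd_eq {m : ℕ} (hm : m % 4 = 3) (j : ℕ) :
    J(-(m : ℤ) | 2 * j + 1) = J(((2 * j + 1 : ℕ) : ℤ) | m) := by
  rw [jacobiSym.neg _ (by simp), jacobiSym_odd_eq hm, ZMod.χ₄_eq_neg_one_pow (by omega),
    show (2 * j + 1) / 2 = j by omega, ← mul_assoc, ← mul_pow]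
  simp

/-- The absolute value, harmless since cosine is even, brings the angle into `[0, π)`, where
`hasSum_cos_odd` holds. It is the source of the two cases in the final formula. -/
lemma neg_one_pow_mul_sin_odd (j : ℕ) (θ : ℝ) :
    (-1) ^ j * Real.sin ((2 * j + 1) * θ) = Real.cos ((2 * j + 1) * |Real.pi / 2 - θ|) := by
  have h : Real.cos ((2 * j + 1) * |Real.pi / 2 - θ|) =
      Real.cos ((2 * j + 1) * (Real.pi / 2 - θ)) := by
    rcases abs_choice (Real.pi / 2 - θ) with h | h
    · rw [h]
    · rw [h, mul_neg, Real.cos_neg]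
  rw [h, show (2 * j + 1) * (Real.pi / 2 - θ) = (Real.pi / 2 - (2 * j + 1) * θ) + j * Real.pi by
    ring, Real.cos_add_nat_mul_pi, Real.cos_pi_div_two_sub]

/-- The angle `2 π k / m`. -/
noncomputable def angle (m k : ℕ) : ℝ := 2 * Real.pi * k / m

lemma tendsto_dirichletPartialSum {t : ℕ} {M : ℤ} {e : ℕ} {g : ℕ → ℕ → ℝ} {B : ℕ → ℝ}
    (hg : ∀ j, (J(-M | 2 * j + 1) : ℝ) * √((4 * t + 3 : ℕ) : ℝ) =
      2 * ∑ k ∈ Finset.Icc 1 (2 * t + 1), (J((k : ℤ) | 4 * t + 3) : ℝ) * g k j)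
    (hB : ∀ k ∈ Finset.Icc 1 (2 * t + 1),
      Tendsto (fun N => ∑ j ∈ Finset.range N, g k j / (2 * j + 1 : ℝ) ^ e) atTop (𝓝 (B k))) :
    Tendsto (dirichletPartialSum M e) atTop
      (𝓝 (2 / √((4 * t + 3 : ℕ) : ℝ) *
        ∑ k ∈ Finset.Icc 1 (2 * t + 1), (J((k : ℤ) | 4 * t + 3) : ℝ) * B k)) := by
  have hsq : √((4 * t + 3 : ℕ) : ℝ) ≠ 0 := (Real.sqrt_pos.mpr (by positivity)).ne'
  have hdiv : Tendsto (fun N : ℕ => N / 2) atTop atTop :=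
    Nat.tendsto_div_const_atTop two_ne_zero
  have key := ((tendsto_finsetSum _ fun k hk =>
    (hB k hk).const_mul (J((k : ℤ) | 4 * t + 3) : ℝ)).const_mul
      (2 / √((4 * t + 3 : ℕ) : ℝ))).comp hdiv
  refine key.congr fun N => ?_
  rw [dirichletPartialSum, sum_filter_odd_range, Function.comp_apply]
  simp_rw [Finset.mul_sum]
  rw [Finset.sum_comm]
  refine Finset.sum_congr rfl fun j _ => ?_
  have h := hg j
  rw [← eq_div_iff hsq] at h
  rw [h, Finset.mul_sum, Finset.sum_div, Finset.sum_div]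
  push_cast
  refine Finset.sum_congr rfl fun k _ => ?_
  ring

/-! ### Assembling the exponential generating function -/

lemma zpow_neg_eq (m e : ℕ) (i : ℤ) (hi : i = -(e : ℤ)) :
    (Real.pi / (2 * m)) ^ i = (2 * m / Real.pi) ^ e := by
  rw [hi, zpow_neg, zpow_natCast, ← inv_pow, inv_div]

lemma K_eq_one {m : ℕ} (hm : m ≠ 1) : K m = 1 := if_neg hm

lemma s_two_mul_mul (m n : ℕ) (hm : m ≠ 1) (x : ℂ) :
    (s m (2 * n) : ℂ) * (x ^ (2 * n) / ((2 * n).factorial : ℂ)) =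
      (L (m : ℤ) (2 * n + 1) : ℂ) * ((√(m : ℝ) : ℝ) : ℂ)⁻¹ * (2 * m / Real.pi) ^ (2 * n + 1) *
        x ^ (2 * n) := by
  have hf : ((2 * n).factorial : ℂ) ≠ 0 := by exact_mod_cast (2 * n).factorial_ne_zero
  rw [s, if_pos (even_two_mul n), Nat.mul_div_cancel_left n two_pos, c, K_eq_one hm,
    zpow_neg_eq m (2 * n + 1) _ (by push_cast; ring)]
  push_cast
  field_simp

lemma s_two_mul_add_one_mul (m n : ℕ) (hm : m ≠ 1) (x : ℂ) :
    (s m (2 * n + 1) : ℂ) * (x ^ (2 * n + 1) / ((2 * n + 1).factorial : ℂ)) =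
      (L (-(m : ℤ)) (2 * (n + 1)) : ℂ) * ((√(m : ℝ) : ℝ) : ℂ)⁻¹ *
        (2 * m / Real.pi) ^ (2 * n + 2) * x ^ (2 * n + 1) := by
  have hf : ((2 * n + 1).factorial : ℂ) ≠ 0 := by exact_mod_cast (2 * n + 1).factorial_ne_zero
  rw [s, if_neg (by simp), show (2 * n + 1 + 1) / 2 = n + 1 by omega, d, K_eq_one hm,
    zpow_neg_eq m (2 * n + 2) _ (by push_cast; ring), show 2 * (n + 1) - 1 = 2 * n + 1 by omega]
  push_cast
  field_simp

lemma angle_mem_Ioo {t k : ℕ} (hk : k ∈ Finset.Icc 1 (2 * t + 1)) :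
    angle (4 * t + 3) k ∈ Set.Ioo 0 Real.pi := by
  rw [Finset.mem_Icc] at hk
  have hk1 : (0 : ℝ) < k := by exact_mod_cast hk.1
  have hm : (0 : ℝ) < (4 * t + 3 : ℕ) := by positivity
  refine ⟨by rw [angle]; positivity, ?_⟩
  rw [angle, div_lt_iff₀ hm]
  have : (2 * k : ℝ) < (4 * t + 3 : ℕ) := by exact_mod_cast (by omega : 2 * k < 4 * t + 3)
  nlinarith [Real.pi_pos]

lemma abs_sub_mem_Ico {θ : ℝ} (hθ : θ ∈ Set.Ioo 0 Real.pi) :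
    |Real.pi / 2 - θ| ∈ Set.Ico 0 Real.pi :=
  ⟨abs_nonneg _, by rw [abs_lt]; constructor <;> linarith [hθ.1, hθ.2]⟩

/-- The contribution of the angle `2 π k / m` is `Λ_{m,4k}` when `4 k < m`. -/
lemma cos_add_sin_eq_Lam {m k : ℕ} (hm : m ≠ 0) (hk : 4 * k ≤ m) (x : ℂ) :
    Complex.cos (2 * m / Real.pi * x * (Real.pi / 2 - angle m k)) /
        Complex.cos (2 * m / Real.pi * x * (Real.pi / 2)) +
      Complex.sin (2 * m / Real.pi * x * (Real.pi / 2 - |Real.pi / 2 - angle m k|)) /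
        Complex.cos (2 * m / Real.pi * x * (Real.pi / 2)) = Lam m (4 * k) x := by
  have hpi : (Real.pi : ℂ) ≠ 0 := by exact_mod_cast Real.pi_ne_zero
  have hm0 : (m : ℂ) ≠ 0 := by exact_mod_cast hm
  have hm' : (0 : ℝ) < m := by exact_mod_cast Nat.pos_of_ne_zero hm
  have habs : |Real.pi / 2 - angle m k| = Real.pi / 2 - angle m k := by
    apply abs_of_nonneg
    rw [angle, sub_nonneg, div_le_div_iff₀ hm' two_pos]
    have : (4 * k : ℝ) ≤ m := by exact_mod_cast hk
    nlinarith [Real.pi_pos]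
  rw [habs, Lam, add_div, angle]
  push_cast
  congr 3 <;> field_simp <;> ring

/-- The contribution of the angle `2 π k / m` is `Λ_{m,2m-4k}` when `m < 4 k`. -/
lemma cos_add_sin_eq_Lam' {m k : ℕ} (hm : m ≠ 0) (hk : m ≤ 4 * k) (x : ℂ) :
    Complex.cos (2 * m / Real.pi * x * (Real.pi / 2 - angle m k)) /
        Complex.cos (2 * m / Real.pi * x * (Real.pi / 2)) +
      Complex.sin (2 * m / Real.pi * x * (Real.pi / 2 - |Real.pi / 2 - angle m k|)) /
        Complex.cos (2 * m / Real.pi * x * (Real.pi / 2)) = Lam m (2 * m - 4 * k) x := by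
  have hpi : (Real.pi : ℂ) ≠ 0 := by exact_mod_cast Real.pi_ne_zero
  have hm0 : (m : ℂ) ≠ 0 := by exact_mod_cast hm
  have hm' : (0 : ℝ) < m := by exact_mod_cast Nat.pos_of_ne_zero hm
  have habs : |Real.pi / 2 - angle m k| = -(Real.pi / 2 - angle m k) := by
    apply abs_of_nonpos
    rw [angle, sub_nonpos, div_le_div_iff₀ two_pos hm']
    have : (m : ℝ) ≤ 4 * k := by exact_mod_cast hk
    nlinarith [Real.pi_pos]
  rw [habs, Lam, add_div, angle, ← Complex.cos_neg (2 * m / Real.pi * x * (Real.pi / 2 - _))]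
  push_cast
  congr 3 <;> field_simp <;> ring

lemma jacobiSym_neg_mul_sqrt {m t : ℕ} (hsq : Squarefree m) (hm : m = 4 * t + 3) (j : ℕ) :
    (J(-(m : ℤ) | 2 * j + 1) : ℝ) * √(m : ℝ) =
      2 * ∑ k ∈ Finset.Icc 1 (2 * t + 1), (J((k : ℤ) | m) : ℝ) *
        Real.sin ((2 * j + 1) * angle m k) := by
  subst hm
  rw [jacobiSym_neg_odd_eq (by omega), jacobiSym_mul_sqrt hsq]
  push_cast
  simp only [angle]
  push_cast
  rfl

lemma jacobiSym_pos_mul_sqrt {m t : ℕ} (hsq : Squarefree m) (hm : m = 4 * t + 3) (j : ℕ) :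
    (J((m : ℤ) | 2 * j + 1) : ℝ) * √(m : ℝ) =
      2 * ∑ k ∈ Finset.Icc 1 (2 * t + 1), (J((k : ℤ) | m) : ℝ) *
        Real.cos ((2 * j + 1) * |Real.pi / 2 - angle m k|) := by
  have h := jacobiSym_neg_mul_sqrt hsq hm j
  rw [jacobiSym_neg_odd_eq (by omega)] at h
  rw [jacobiSym_odd_eq (by omega)]
  push_cast at h ⊢
  rw [mul_assoc, h, mul_left_comm, Finset.mul_sum]
  congr 1
  refine Finset.sum_congr rfl fun k _ => ?_
  rw [← neg_one_pow_mul_sin_odd]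
  ring

/-- The sine series `∑ sin (l θ) / l ^ (2n+1)` over odd `l` converge at the angles `2 π k / m`, and
`L_m (2n+1)` is a combination of them. -/
lemma exists_sin_series {m t : ℕ} (hsq : Squarefree m) (hm : m = 4 * t + 3) :
    ∃ B : ℕ → ℕ → ℝ,
      (∀ k ∈ Finset.Icc 1 (2 * t + 1), ∀ n : ℕ, Tendsto (fun N => ∑ j ∈ Finset.range N,
        Real.sin ((2 * j + 1) * angle m k) / (2 * j + 1 : ℝ) ^ (2 * n + 1)) atTop (𝓝 (B k n))) ∧
      ∀ n, Tendsto (dirichletPartialSum (m : ℤ) (2 * n + 1)) atTop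
        (𝓝 (2 / √(m : ℝ) * ∑ k ∈ Finset.Icc 1 (2 * t + 1), (J((k : ℤ) | m) : ℝ) * B k n)) := by
  have exB : ∀ k ∈ Finset.Icc 1 (2 * t + 1), ∀ n : ℕ, ∃ B : ℝ, Tendsto (fun N =>
      ∑ j ∈ Finset.range N, Real.sin ((2 * j + 1) * angle m k) / (2 * j + 1 : ℝ) ^ (2 * n + 1))
      atTop (𝓝 B) := by
    intro k hk n
    cases n with
    | zero =>
      subst hm
      exact ⟨_, by simpa using tendsto_sum_sin_odd_div (angle_mem_Ioo hk)⟩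
    | succ n => exact exists_tendsto_sum_div_odd_pow (fun j => Real.abs_sin_le_one _) (2 * n + 1)
  choose! B hB using exB
  refine ⟨B, hB, fun n => ?_⟩
  have g := jacobiSym_neg_mul_sqrt hsq hm
  subst hm
  exact tendsto_dirichletPartialSum g fun k hk => hB k hk n

/-- The analogue of `exists_sin_series` for `L_{-m} (2n+2)`. -/
lemma exists_cos_series {m t : ℕ} (hsq : Squarefree m) (hm : m = 4 * t + 3) :
    ∃ C : ℕ → ℕ → ℝ,
      (∀ k n : ℕ, Tendsto (fun N => ∑ j ∈ Finset.range N,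
        Real.cos ((2 * j + 1) * |Real.pi / 2 - angle m k|) / (2 * j + 1 : ℝ) ^ (2 * n + 2))
        atTop (𝓝 (C k n))) ∧
      ∀ n, Tendsto (dirichletPartialSum (-(m : ℤ)) (2 * (n + 1))) atTop
        (𝓝 (2 / √(m : ℝ) * ∑ k ∈ Finset.Icc 1 (2 * t + 1), (J((k : ℤ) | m) : ℝ) * C k n)) := by
  have exC : ∀ k : ℕ, ∀ n : ℕ, ∃ C : ℝ, Tendsto (fun N => ∑ j ∈ Finset.range N,
      Real.cos ((2 * j + 1) * |Real.pi / 2 - angle m k|) / (2 * j + 1 : ℝ) ^ (2 * n + 2))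
      atTop (𝓝 C) :=
    fun k n => exists_tendsto_sum_div_odd_pow (fun j => Real.abs_cos_le_one _) (2 * n)
  choose C hC using exC
  refine ⟨C, hC, fun n => ?_⟩
  have g : ∀ j : ℕ, (J(-(-(m : ℤ)) | 2 * j + 1) : ℝ) * √(m : ℝ) =
      2 * ∑ k ∈ Finset.Icc 1 (2 * t + 1), (J((k : ℤ) | m) : ℝ) *
        Real.cos ((2 * j + 1) * |Real.pi / 2 - angle m k|) := fun j => by
    rw [neg_neg]
    exact jacobiSym_pos_mul_sqrt hsq hm j
  subst hm
  exact tendsto_dirichletPartialSum g fun k _ => hC k n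

/-- The normalization of `s_{m,n}`, the `2/√m` of the finite Fourier expansion and one factor `2m/π`
combine into the `4/π` of the power series; the other factors `2m/π` turn `x` into `z`. -/
lemma two_div_sqrt_mul {m : ℕ} (hm : m ≠ 0) :
    2 / ((√(m : ℝ) : ℝ) : ℂ) * ((√(m : ℝ) : ℝ) : ℂ)⁻¹ * (2 * m / Real.pi) = 4 / Real.pi := by
  have hpi : (Real.pi : ℂ) ≠ 0 := by exact_mod_cast Real.pi_ne_zero
  have hmC : (m : ℂ) ≠ 0 := by exact_mod_cast hm
  have hroot : ((√(m : ℝ) : ℝ) : ℂ) * ((√(m : ℝ) : ℝ) : ℂ) = m := by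
    rw [← Complex.ofReal_mul, Real.mul_self_sqrt m.cast_nonneg, Complex.ofReal_natCast]
  have hr0 : ((√(m : ℝ) : ℝ) : ℂ) ≠ 0 := fun h => hmC (by rw [← hroot, h, zero_mul])
  field_simp
  linear_combination (-4) * hroot

lemma sum_mul_pow_eq {m : ℕ} (hm : m ≠ 0) (S : Finset ℕ) (f B : ℕ → ℂ) (x : ℂ) (e : ℕ) :
    2 / ((√(m : ℝ) : ℝ) : ℂ) * (∑ k ∈ S, f k * B k) * ((√(m : ℝ) : ℝ) : ℂ)⁻¹ *
        (2 * m / Real.pi) ^ (e + 1) * x ^ e =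
      ∑ k ∈ S, f k * (4 / (Real.pi : ℂ) * B k * (2 * m / Real.pi * x) ^ e) := by
  rw [← two_div_sqrt_mul hm, Finset.mul_sum, Finset.sum_mul, Finset.sum_mul, Finset.sum_mul]
  refine Finset.sum_congr rfl fun k _ => ?_
  rw [mul_pow, pow_succ]
  ring

lemma norm_two_mul_div_pi_mul_lt_one {m : ℕ} (hm : m ≠ 0) {x : ℂ}
    (hx : ‖x‖ < Real.pi / (2 * m)) : ‖2 * m / Real.pi * x‖ < 1 := by
  have hmR : (0 : ℝ) < m := by exact_mod_cast Nat.pos_of_ne_zero hm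
  have : ‖(2 * m / Real.pi : ℂ)‖ = 2 * m / Real.pi := by
    rw [show (2 * m / Real.pi : ℂ) = ((2 * m / Real.pi : ℝ) : ℂ) by push_cast; ring,
      Complex.norm_real, Real.norm_of_nonneg (by positivity)]
  rw [norm_mul, this]
  rw [lt_div_iff₀ (by positivity)] at hx
  rw [div_mul_eq_mul_div, div_lt_one Real.pi_pos]
  linarith

lemma hasSum_s_even {m t : ℕ} (hsq : Squarefree m) (hm : m = 4 * t + 3) {x : ℂ}
    (hx : ‖x‖ < Real.pi / (2 * m)) :
    HasSum (fun n : ℕ => (s m (2 * n) : ℂ) * (x ^ (2 * n) / ((2 * n).factorial : ℂ)))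
      (∑ k ∈ Finset.Icc 1 (2 * t + 1), (J((k : ℤ) | m) : ℂ) *
        (Complex.cos (2 * m / Real.pi * x * (Real.pi / 2 - angle m k)) /
          Complex.cos (2 * m / Real.pi * x * (Real.pi / 2)))) := by
  obtain ⟨B, hB, tB⟩ := exists_sin_series hsq hm
  have hm0 : m ≠ 0 := by omega
  have hz := norm_two_mul_div_pi_mul_lt_one hm0 hx
  have key := hasSum_sum fun k (hk : k ∈ Finset.Icc 1 (2 * t + 1)) =>
    (hasSum_pow_even (by rw [hm]; exact angle_mem_Ioo hk) (hB k hk) hz).mul_left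
      (J((k : ℤ) | m) : ℂ)
  refine hasSum_of_eq key (fun n => ?_) rfl
  rw [s_two_mul_mul m n (by omega), L, (tB n).limUnder_eq]
  push_cast
  exact sum_mul_pow_eq hm0 _ _ _ _ _

lemma hasSum_s_odd {m t : ℕ} (hsq : Squarefree m) (hm : m = 4 * t + 3) {x : ℂ}
    (hx : ‖x‖ < Real.pi / (2 * m)) :
    HasSum (fun n : ℕ => (s m (2 * n + 1) : ℂ) *
        (x ^ (2 * n + 1) / ((2 * n + 1).factorial : ℂ)))
      (∑ k ∈ Finset.Icc 1 (2 * t + 1), (J((k : ℤ) | m) : ℂ) *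
        (Complex.sin (2 * m / Real.pi * x * (Real.pi / 2 - |Real.pi / 2 - angle m k|)) /
          Complex.cos (2 * m / Real.pi * x * (Real.pi / 2)))) := by
  obtain ⟨C, hC, tC⟩ := exists_cos_series hsq hm
  have hm0 : m ≠ 0 := by omega
  have hz := norm_two_mul_div_pi_mul_lt_one hm0 hx
  have key := hasSum_sum fun k (hk : k ∈ Finset.Icc 1 (2 * t + 1)) =>
    (hasSum_pow_odd (abs_sub_mem_Ico (by rw [hm]; exact angle_mem_Ioo hk)) (hC k) hz).mul_left
      (J((k : ℤ) | m) : ℂ)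
  refine hasSum_of_eq key (fun n => ?_) rfl
  rw [s_two_mul_add_one_mul m n (by omega), L, (tC n).limUnder_eq]
  push_cast
  exact sum_mul_pow_eq hm0 _ _ _ _ _

end ShanksNumbers

theorem theorem2p1 (m t : ℕ) (hsq : Squarefree m) (hm : m = 4 * t + 3) :
    -- the Dirichlet series that define the numbers `s_{m,n}` converge
    (∀ n : ℕ,
      Tendsto (ShanksNumbers.dirichletPartialSum (m : ℤ) (2 * n + 1)) atTop
        (𝓝 (ShanksNumbers.L (m : ℤ) (2 * n + 1))) ∧
      Tendsto (ShanksNumbers.dirichletPartialSum (-(m : ℤ)) (2 * (n + 1))) atTop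
        (𝓝 (ShanksNumbers.L (-(m : ℤ)) (2 * (n + 1))))) ∧
    -- on the disc `|x| < π/(2m)` the exponential generating function converges to the formula
    (∀ x : ℂ, ‖x‖ < Real.pi / (2 * m) →
      HasSum (fun n : ℕ => (ShanksNumbers.s m n : ℂ) * (x ^ n / (n.factorial : ℂ)))
        ((∑ k ∈ Finset.Icc 1 t,
            (J((k : ℤ) | m) : ℂ) * ShanksNumbers.Lam (m : ℤ) (4 * (k : ℤ)) x) +
          ∑ k ∈ Finset.Icc (t + 1) (2 * t + 1),
            (J((k : ℤ) | m) : ℂ) *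
              ShanksNumbers.Lam (m : ℤ) (2 * (m : ℤ) - 4 * (k : ℤ)) x)) := by
  have hm0 : m ≠ 0 := by omega
  refine ⟨fun n => ⟨?_, ?_⟩, fun x hx => ?_⟩
  · obtain ⟨B, -, tB⟩ := ShanksNumbers.exists_sin_series hsq hm
    rw [ShanksNumbers.L, (tB n).limUnder_eq]
    exact tB n
  · obtain ⟨C, -, tC⟩ := ShanksNumbers.exists_cos_series hsq hm
    rw [ShanksNumbers.L, (tC n).limUnder_eq]
    exact tC n
  -- The cut is at `k = t` because `4t < m < 4(t+1)`, which decides the sign of `π/2 - 2πk/m`.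
  have hsplit : Finset.Icc 1 (2 * t + 1) = Finset.Icc 1 t ∪ Finset.Icc (t + 1) (2 * t + 1) := by
    ext k; simp only [Finset.mem_union, Finset.mem_Icc]; omega
  have hdisj : Disjoint (Finset.Icc 1 t) (Finset.Icc (t + 1) (2 * t + 1)) := by
    rw [Finset.disjoint_left]; intro k; simp only [Finset.mem_Icc]; omega
  have key := HasSum.even_add_odd
    (f := fun n : ℕ => (ShanksNumbers.s m n : ℂ) * (x ^ n / (n.factorial : ℂ)))
    (ShanksNumbers.hasSum_s_even hsq hm hx) (ShanksNumbers.hasSum_s_odd hsq hm hx)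
  rw [← Finset.sum_add_distrib, hsplit, Finset.sum_union hdisj] at key
  refine ShanksNumbers.hasSum_of_eq key (fun _ => rfl) ?_
  congr 1
  · refine Finset.sum_congr rfl fun k hk => ?_
    rw [Finset.mem_Icc] at hk
    rw [← mul_add, ShanksNumbers.cos_add_sin_eq_Lam hm0 (by omega)]
  · refine Finset.sum_congr rfl fun k hk => ?_
    rw [Finset.mem_Icc] at hk
    rw [← mul_add, ShanksNumbers.cos_add_sin_eq_Lam' hm0 (by omega)]
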